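/- Let $M$ be a countable first-order structure. For $X\subseteq M$ let ${\rm Aut}(M/X)$ be the group of automorphisms of $M$ fixing every element of $X$, and let ${\rm orb}(b/X)$ be the ${\rm Aut}(M/X)$-orbit of $b\in M$. Let $d$ be a non-zero integer-valued dimension function on $M$, i.e. $d$ is a function from the finite subsets of $M$ to $\mathbb Z$, not identically zero, such that $d(\emptyset)=0$ and, for all finite $X,Y\subseteq M$ and $g\in{\rm Aut}(M)$, $$d(gX)=d(X),\qquad 0\le d(X)\le d(X\cup Y)\le d(X)+d(Y)-d(X\cap Y).$$ For finite $X$ and arbitrary $Z,S\subseteq M$ put $d(X/Z)=\min\{d(X\cup Y)-d(Y): Y\subseteq Z \text{ finite}\}$, $d(S/Z)=\max\{d(X/Z): X\subseteq S\text{ finite}\}$ when this maximum exists, and ${\rm cl}^d(Z)=\{a\in M: d(\{a\}/Z)=0\}$. Let $\mathcal X=\{{\rm cl}^d(X): X\subseteq M\text{ finite}\}$, and for $A,B,C\in\mathcal X$ write $A\perp^d_B C$ if $d(A/B\cup C)=d(A/B)$. Assume: (a) (${\rm cl}^d$ subsumes definable closure) if $X\subseteq M$ is finite and $a\in M$ is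 fixed by ${\rm Aut}(M/{\rm cl}^d(X))$, then $a\in{\rm cl}^d(X)$; (b) (Existence) for all $A,B,C\in\mathcal X$ there is $g\in{\rm Aut}(M/B)$ with $gA\perp^d_B C$; (c) (Stationarity) if $A_1,A_2,B,C\in\mathcal X$, $B\subseteq A_i$ and $A_i\perp^d_B C$ for $i=1,2$, and $h:A_1\to A_2$ is a bijection which is the identity on $B$ and extends to an automorphism of $M$, then some automorphism of $M$ extends $h\cup{\rm id}_C$. Say that $b\in M$ is basic over $A\in\mathcal X$ if $b\notin A$ and, whenever $A\subseteq C\in\mathcal X$ and $d(\{b\}/C)<d(\{b\}/A)$, then $b\in C$. Suppose that there are $A\in\mathcal X$ and an element $b\in M$ basic over $A$ such that $D={\rm orb}(b/A)$ satisfies ${\rm cl}^d(A\cup D)=M$. Let $G={\rm Aut}(M/{\rm cl}^d(\emptyset))$ and let $g\in G$ be not ${\rm cl}^d$-bounded, i.e. there is no $E\in\mathcal X$ such that $gB=B$ for all $B\in\mathcal X$ with $E\subseteq B$. Then every element of $G$ is a product of $96$ elements, each of which is a conjugate in $G$ of $g$ or of $g^{-1}$. -/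

import Mathlib

namespace DimIndep

open scoped FirstOrder

universe u v w

noncomputable section

open scoped Classical

/-- `Aut(M)`: the automorphisms of a first-order structure form a group under composition. -/
instance autGroup (L : FirstOrder.Language.{u, v}) (M : Type w) [L.Structure M] : Group (M ≃[L] M) where
  mul f g := f.comp g
  one := FirstOrder.Language.Equiv.refl L M
  inv f := f.symm
  mul_assoc _ _ _ := rfl
  one_mul _ := rfl
  mul_one _ := rfl
  inv_mul_cancel f := FirstOrder.Language.Equiv.symm_comp_self f

/-- `Aut(M/X)`: the automorphisms fixing every element of `X`. -/
def autFix (L : FirstOrder.Language.{u, v}) {M : Type w} [L.Structure M] (X : Set M) :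
    Subgroup (M ≃[L] M) where
  carrier := {f | ∀ x ∈ X, f x = x}
  mul_mem' {f g} hf hg x hx := by
    change f (g x) = x
    rw [hg x hx, hf x hx]
  one_mem' _ _ := rfl
  inv_mem' {f} hf x hx := by
    change f.symm x = x
    conv_lhs => rw [← hf x hx]
    exact f.symm_apply_apply x

/-- `orb(b/X)`: the orbit of `b` under `Aut(M/X)`. -/
def orb (L : FirstOrder.Language.{u, v}) {M : Type w} [L.Structure M] (b : M) (X : Set M) : Set M :=
  {c | ∃ f ∈ autFix L X, f b = c}

/-- Integer-valued dimension functions on `M`, normalised by `d(∅) = 0`. -/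
structure IsDimensionFunction (L : FirstOrder.Language.{u, v}) {M : Type w} [L.Structure M]
    (d : Finset M → ℤ) : Prop where
  invariant : ∀ (g : M ≃[L] M) (X : Finset M), d (X.image g) = d X
  nonneg : ∀ X : Finset M, 0 ≤ d X
  mono : ∀ X Y : Finset M, d X ≤ d (X ∪ Y)
  submodular : ∀ X Y : Finset M, d (X ∪ Y) ≤ d X + d Y - d (X ∩ Y)
  empty : d ∅ = 0

section

variable {M : Type w}

/-- `d(X/Z) = min {d(X ∪ Y) - d(Y) : Y ⊆ Z finite}` for `X` finite and `Z` arbitrary. The set of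
integers is nonempty and bounded below by `0` when `d` is a dimension function, so that the
infimum is a minimum. -/
def relDim (d : Finset M → ℤ) (X : Finset M) (Z : Set M) : ℤ :=
  sInf {n : ℤ | ∃ Y : Finset M, (Y : Set M) ⊆ Z ∧ n = d (X ∪ Y) - d Y}

/-- `d(A/Z) = max {d(X/Z) : X ⊆ A finite}` for `A` arbitrary. It is only used for `A` the
`d`-closure of a finite set, where the set of integers is nonempty and bounded above. -/
def setDim (d : Finset M → ℤ) (A Z : Set M) : ℤ :=
  sSup {n : ℤ | ∃ X : Finset M, (X : Set M) ⊆ A ∧ n = relDim d X Z}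

/-- The `d`-closure `cl^d(Z)`. -/
def dClosure (d : Finset M → ℤ) (Z : Set M) : Set M :=
  {a | relDim d {a} Z = 0}

/-- The collection `𝒳` of `d`-closures of finite sets. -/
def closures (d : Finset M → ℤ) : Set (Set M) :=
  {A | ∃ X : Finset M, A = dClosure d (X : Set M)}

/-- `d`-independence of `A` and `C` over `B`. -/
def Indep (d : Finset M → ℤ) (A B C : Set M) : Prop :=
  setDim d A (B ∪ C) = setDim d A B

/-- `b` is basic over `A`. -/
def IsBasic (d : Finset M → ℤ) (b : M) (A : Set M) : Prop :=
  b ∉ A ∧ ∀ C ∈ closures d, A ⊆ C → relDim d {b} C < relDim d {b} A → b ∈ C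

end

section

variable (L : FirstOrder.Language.{u, v}) {M : Type w} [L.Structure M]

/-- `cl^d` subsumes definable closure. -/
def SubsumesDefinableClosure (d : Finset M → ℤ) : Prop :=
  ∀ (X : Finset M) (a : M),
    (∀ f ∈ autFix L (dClosure d (X : Set M)), f a = a) → a ∈ dClosure d (X : Set M)

/-- The Existence axiom for `d`-independence. -/
def Existence (d : Finset M → ℤ) : Prop :=
  ∀ A ∈ closures d, ∀ B ∈ closures d, ∀ C ∈ closures d,
    ∃ g ∈ autFix L B, Indep d (g '' A) B C

/-- The Stationarity axiom for `d`-independence. A partial automorphism `A₁ → A₂` is the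
restriction to `A₁` of an automorphism `h` with `h '' A₁ = A₂`. -/
def Stationary (d : Finset M → ℤ) : Prop :=
  ∀ A₁ ∈ closures d, ∀ A₂ ∈ closures d, ∀ B ∈ closures d, ∀ C ∈ closures d,
    B ⊆ A₁ → B ⊆ A₂ → Indep d A₁ B C → Indep d A₂ B C →
    ∀ h : M ≃[L] M, h '' A₁ = A₂ → (∀ b ∈ B, h b = b) →
      ∃ k : M ≃[L] M, (∀ a ∈ A₁, k a = h a) ∧ ∀ c ∈ C, k c = c

/-- The standing assumption on `d`: a non-zero dimension function whose closure subsumes definable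
closure and whose independence relation satisfies Existence. -/
structure StandingAssumption (d : Finset M → ℤ) : Prop where
  isDimensionFunction : IsDimensionFunction L d
  nonzero : ∃ X : Finset M, d X ≠ 0
  subsumes : SubsumesDefinableClosure L d
  existence : Existence L d

/-- `D` is a basic `Aut(M/A)`-orbit. -/
def IsBasicOrbit (d : Finset M → ℤ) (D A : Set M) : Prop :=
  ∃ b : M, IsBasic d b A ∧ D = orb L b A

variable {L}

/-- `g` is `cl^d`-bounded: it stabilises setwise every member of `𝒳` containing some fixed
`E ∈ 𝒳`. -/
def IsClBounded (d : Finset M → ℤ) (g : M ≃[L] M) : Prop :=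
  ∃ E ∈ closures d, ∀ B ∈ closures d, E ⊆ B → g '' B = B

end

end

end DimIndep

/-! ## Submodular functions on finite sets -/

/-! Closures of finite sets play the role of basic open sets: a neighbourhood of an automorphism
consists of those agreeing with it on the closure of a finite set. The proof has three stages.

Unboundedness is first turned into genericity (`IsGeneratingBasicOrbit.movesAlmostMaximally`): any
finite tuple has a conjugate over a given finite `B` which `g` sends to something independent from
it over `B`. In the basic orbit `D`, an element outside a closure containing `A` always adds the
same dimension `δ`, so `D` behaves like a pregeometry with `δ` as unit. It suffices to move
independent tuples from `D`, one element at a time, since `D` generates `M` over `A`.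

Next, consider the map sending four conjugators to the product of the corresponding four conjugates
of `g`. By `IsIndepSystem.exists_four_conj_agree`, a chain of four finite configurations in general
position can be perturbed to reach any prescribed target: work inwards from both ends, choose a
generic middle configuration, and join it to each side by Stationarity. So the image of every
nonempty open set is dense in some nonempty open set (`locallyDense_fourConj`).

Finally, for any `f` the products of four conjugates and their left translates by `f` are both dense
in a common nonempty open set, because the first family is conjugation invariant and conjugation is
topologically transitive. A Baire-type game, with countability of `M` and completeness of the group,
produces a common value (`GameState.exists_eq`). Hence `f` is a product of eight conjugates of `g`
and `g⁻¹`. Padding with pairs `g, g⁻¹` gives length 96. -/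

namespace DimIndep

open scoped Pointwise

section Submodular

variable {M : Type*} [DecidableEq M]

/-- Monotone submodular integer-valued functions on finite sets. -/
structure IsMonoSubmodular (d : Finset M → ℤ) : Prop where
  mono : ∀ {X Y : Finset M}, X ⊆ Y → d X ≤ d Y
  submod : ∀ X Y : Finset M, d (X ∪ Y) + d (X ∩ Y) ≤ d X + d Y

/-- The finite set `Y` is contained in the `d`-closure of the finite set `X`. -/
def SubCl (d : Finset M → ℤ) (Y X : Finset M) : Prop := d (X ∪ Y) = d X

/-- Independence of finite sets `A` and `C` over the finite set `B`. -/
def FinIndep (d : Finset M → ℤ) (A B C : Finset M) : Prop :=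
  d (A ∪ B ∪ C) + d B = d (A ∪ B) + d (B ∪ C)

variable {d : Finset M → ℤ}

namespace IsMonoSubmodular

/-- Monotonicity frees submodularity from exact unions and intersections. Most of the calculus of
closure and independence below rests on this form. -/
theorem submod_of_subset (hd : IsMonoSubmodular d) {U Z X Y : Finset M} (hU : U ⊆ X ∪ Y)
    (hX : Z ⊆ X) (hY : Z ⊆ Y) : d U + d Z ≤ d X + d Y := by
  have h1 := hd.mono hU
  have h2 := hd.mono (Finset.subset_inter hX hY)
  have h3 := hd.submod X Y
  linarith

theorem subCl_of_le (hd : IsMonoSubmodular d) {X Y : Finset M} (h : d (X ∪ Y) ≤ d X) :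
    SubCl d Y X :=
  le_antisymm h (hd.mono Finset.subset_union_left)

theorem subCl_of_subset {X Y : Finset M} (h : Y ⊆ X) : SubCl d Y X := by
  unfold SubCl; rw [Finset.union_eq_left.2 h]

theorem subCl_mono (hd : IsMonoSubmodular d) {X X' Y Y' : Finset M} (h : SubCl d Y X)
    (hX : X ⊆ X') (hY : Y' ⊆ Y) : SubCl d Y' X' := by
  apply hd.subCl_of_le
  have := hd.submod_of_subset (U := X' ∪ Y') (Z := X) (X := X') (Y := X ∪ Y)
    (by grind) hX (by grind)
  unfold SubCl at h; linarith

theorem subCl_union (hd : IsMonoSubmodular d) {X Y Z : Finset M} (hY : SubCl d Y X)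
    (hZ : SubCl d Z X) : SubCl d (Y ∪ Z) X := by
  apply hd.subCl_of_le
  have := hd.submod_of_subset (U := X ∪ (Y ∪ Z)) (Z := X) (X := X ∪ Y) (Y := X ∪ Z)
    (by grind) (by grind) (by grind)
  unfold SubCl at hY hZ; linarith

theorem subCl_trans (hd : IsMonoSubmodular d) {X Y Z : Finset M} (hZ : SubCl d Z Y)
    (hY : SubCl d Y X) : SubCl d Z X := by
  apply hd.subCl_of_le
  have h1 := hd.subCl_mono hZ (Finset.subset_union_right : Y ⊆ X ∪ Y) subset_rfl
  have h2 := hd.mono (show X ∪ Z ⊆ X ∪ Y ∪ Z by grind)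
  unfold SubCl at h1 hY; linarith

theorem subCl_of_forall (hd : IsMonoSubmodular d) {X Y : Finset M}
    (h : ∀ y ∈ Y, SubCl d {y} X) : SubCl d Y X := by
  induction Y using Finset.induction_on with
  | empty => exact subCl_of_subset (Finset.empty_subset _)
  | insert y Y _ ih =>
    rw [Finset.insert_eq]
    exact hd.subCl_union (h y (by simp)) (ih fun z hz => h z (by simp [hz]))

theorem subCl_union_union (hd : IsMonoSubmodular d) {X Y Z W : Finset M} (h : SubCl d Y X)
    (h' : SubCl d W Z) : SubCl d (Y ∪ W) (X ∪ Z) :=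
  hd.subCl_union (hd.subCl_mono h Finset.subset_union_left subset_rfl)
    (hd.subCl_mono h' Finset.subset_union_right subset_rfl)

theorem finIndep_of_le (hd : IsMonoSubmodular d) {A B C : Finset M}
    (h : d (A ∪ B) + d (B ∪ C) ≤ d (A ∪ B ∪ C) + d B) : FinIndep d A B C :=
  le_antisymm (hd.submod_of_subset (by grind) (by grind) (by grind)) h

theorem finIndep_symm {A B C : Finset M} (h : FinIndep d A B C) : FinIndep d C B A := by
  unfold FinIndep at *
  rw [show C ∪ B ∪ A = A ∪ B ∪ C by grind, Finset.union_comm C B, Finset.union_comm B A]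
  linarith

theorem finIndep_right (hd : IsMonoSubmodular d) {A B C C' : Finset M} (h : FinIndep d A B C)
    (hC : SubCl d C' (B ∪ C)) : FinIndep d A B C' := by
  apply hd.finIndep_of_le
  have h1 := hd.submod_of_subset (U := A ∪ B ∪ C) (Z := B ∪ C') (X := A ∪ B ∪ C')
    (Y := B ∪ C ∪ C') (by grind) (by grind) (by grind)
  unfold FinIndep at h; unfold SubCl at hC; linarith

theorem finIndep_left (hd : IsMonoSubmodular d) {A A' B C : Finset M} (h : FinIndep d A B C)
    (hA : SubCl d A' (B ∪ A)) : FinIndep d A' B C :=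
  finIndep_symm (hd.finIndep_right (finIndep_symm h) hA)

theorem finIndep_mono (hd : IsMonoSubmodular d) {A A' B C C' : Finset M} (h : FinIndep d A B C)
    (hA : A' ⊆ B ∪ A) (hC : C' ⊆ B ∪ C) : FinIndep d A' B C' :=
  hd.finIndep_left (hd.finIndep_right h (subCl_of_subset hC)) (subCl_of_subset hA)

theorem finIndep_trans {A B C E : Finset M} (h : FinIndep d A B C)
    (h' : FinIndep d A (B ∪ C) E) : FinIndep d A B (C ∪ E) := by
  unfold FinIndep at *
  rw [show A ∪ B ∪ (C ∪ E) = A ∪ (B ∪ C) ∪ E by grind,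
    show B ∪ (C ∪ E) = B ∪ C ∪ E by grind]
  rw [show A ∪ B ∪ C = A ∪ (B ∪ C) by grind] at h
  linarith

theorem finIndep_base (hd : IsMonoSubmodular d) {A B C E : Finset M}
    (h : FinIndep d A B (C ∪ E)) : FinIndep d A (B ∪ C) E := by
  have h1 := hd.finIndep_mono h (A' := A) (C' := C) (by grind) (by grind)
  unfold FinIndep at *
  rw [show A ∪ B ∪ (C ∪ E) = A ∪ (B ∪ C) ∪ E by grind,
    show B ∪ (C ∪ E) = B ∪ C ∪ E by grind] at h
  rw [show A ∪ B ∪ C = A ∪ (B ∪ C) by grind] at h1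
  linarith

/-- A set in the closures of two sets independent over `B` is in the closure of `B`. -/
theorem subCl_of_finIndep (hd : IsMonoSubmodular d) {A B C X : Finset M} (h : FinIndep d A B C)
    (hA : SubCl d X (B ∪ A)) (hC : SubCl d X (B ∪ C)) : SubCl d X B := by
  have h1 := hd.finIndep_left (hd.finIndep_right h hC) hA
  unfold FinIndep at h1
  unfold SubCl
  rw [show X ∪ B ∪ X = X ∪ B by grind] at h1
  linarith

end IsMonoSubmodular

end Submodular

/-! ## Independence systems -/

/-- `s` and `t` agree on the `d`-closure of `X`. -/
def AgreeOn {G M : Type*} [DecidableEq M] [SMul G M] (d : Finset M → ℤ) (X : Finset M)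
    (s t : G) : Prop :=
  ∀ a, SubCl d {a} X → s • a = t • a

/-- A group acting on `M` by automorphisms fixing the closure of the empty set, which satisfies
Existence and Stationarity for the independence relation of `d` and is complete for pointwise
convergence. -/
structure IsIndepSystem (G : Type*) {M : Type*} [DecidableEq M] [Group G] [MulAction G M]
    (d : Finset M → ℤ) : Prop extends IsMonoSubmodular d where
  smul_eq : ∀ (g : G) (X : Finset M), d (g • X) = d X
  agree_empty : ∀ s t : G, AgreeOn d ∅ s t
  existence : ∀ A B C : Finset M, ∃ g : G, AgreeOn d B g 1 ∧ FinIndep d (g • A) B C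
  stationary : ∀ (A B C : Finset M) (h : G), AgreeOn d B h 1 → FinIndep d A B C →
    FinIndep d (h • A) B C → ∃ k : G, AgreeOn d C k 1 ∧ AgreeOn d (A ∪ B) k h
  faithful : ∀ s t : G, (∀ m : M, s • m = t • m) → s = t
  complete : ∀ (X : ℕ → Finset M) (s : ℕ → G), (∀ n, X n ⊆ X (n + 1)) → (∀ m, ∃ n, m ∈ X n) →
    (∀ m, ∃ n, (s n)⁻¹ • m ∈ X n) → (∀ n, AgreeOn d (X n) (s (n + 1)) (s n)) →
    ∃ t : G, ∀ n, AgreeOn d (X n) t (s n)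

/-! ### Agreement of group elements on closures of finite sets. -/

section Agree

variable {G M : Type*} [DecidableEq M] [Group G] [MulAction G M] {d : Finset M → ℤ}

namespace AgreeOn

theorem symm {X : Finset M} {s t : G} (h : AgreeOn d X s t) : AgreeOn d X t s :=
  fun a ha => (h a ha).symm

theorem trans {X : Finset M} {s t u : G} (h : AgreeOn d X s t) (h' : AgreeOn d X t u) :
    AgreeOn d X s u :=
  fun a ha => (h a ha).trans (h' a ha)

theorem refl (X : Finset M) (s : G) : AgreeOn d X s s := fun _ _ => rfl

theorem apply {X : Finset M} {s t : G} (h : AgreeOn d X s t) {x : M} (hx : x ∈ X) :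
    s • x = t • x :=
  h x (IsMonoSubmodular.subCl_of_subset (by simpa using hx))

theorem smul_finset_eq {X Y : Finset M} {s t : G} (h : AgreeOn d X s t) (hY : Y ⊆ X) :
    s • Y = t • Y := by
  change Y.image _ = Y.image _
  exact Finset.image_congr fun y hy => h.apply (hY hy)

theorem smul_finset_self {X Y : Finset M} {s : G} (h : AgreeOn d X s 1) (hY : Y ⊆ X) :
    s • Y = Y := by
  rw [h.smul_finset_eq hY, one_smul]

theorem mul_left {X : Finset M} {s t : G} (h : AgreeOn d X s t) (u : G) :
    AgreeOn d X (u * s) (u * t) := fun a ha => by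
  rw [mul_smul, mul_smul, h a ha]

theorem inv_one {X : Finset M} {s : G} (h : AgreeOn d X s 1) : AgreeOn d X s⁻¹ 1 :=
  fun a ha => by
    have := h a ha
    rw [one_smul] at this ⊢
    rw [inv_smul_eq_iff, this]

theorem mul_one {X : Finset M} {s t : G} (h : AgreeOn d X s 1) (h' : AgreeOn d X t 1) :
    AgreeOn d X (s * t) 1 :=
  fun a ha => by
    rw [mul_smul, h' a ha, one_smul, h a ha, one_smul]

end AgreeOn

namespace IsIndepSystem

theorem agree_of_subCl (H : IsIndepSystem G d)
    {X Y : Finset M} {s t : G} (h : AgreeOn d X s t) (hY : SubCl d Y X) :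
    AgreeOn d Y s t :=
  fun a ha => h a (H.subCl_trans ha hY)

theorem agree_mono (H : IsIndepSystem G d)
    {X Y : Finset M} {s t : G} (h : AgreeOn d X s t) (hY : Y ⊆ X) :
    AgreeOn d Y s t :=
  H.agree_of_subCl h (IsMonoSubmodular.subCl_of_subset hY)

theorem subCl_smul_iff (H : IsIndepSystem G d)
    (g : G) {X Y : Finset M} : SubCl d (g • Y) (g • X) ↔ SubCl d Y X := by
  unfold SubCl
  rw [← Finset.smul_finset_union, H.smul_eq, H.smul_eq]

theorem finIndep_smul_iff (H : IsIndepSystem G d) (g : G) {A B C : Finset M} :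
    FinIndep d (g • A) (g • B) (g • C) ↔ FinIndep d A B C := by
  unfold FinIndep
  simp only [← Finset.smul_finset_union, H.smul_eq]

theorem subCl_smul_singleton_iff (H : IsIndepSystem G d) (g : G) {X : Finset M} {a : M} :
    SubCl d {g • a} (g • X) ↔ SubCl d {a} X := by
  rw [← Finset.smul_finset_singleton, H.subCl_smul_iff]

theorem agree_smul (H : IsIndepSystem G d)
    {X : Finset M} {s t u : G} (h : AgreeOn d X (s * u) (t * u)) :
    AgreeOn d (u • X) s t := fun a ha => by
  have h1 := h (u⁻¹ • a) (by rw [← H.subCl_smul_singleton_iff u, smul_inv_smul]; exact ha)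
  simpa [mul_smul] using h1

theorem agree_mul_right (H : IsIndepSystem G d)
    {X : Finset M} {s t u : G} (h : AgreeOn d (u • X) s t) :
    AgreeOn d X (s * u) (t * u) := fun a ha => by
  rw [mul_smul, mul_smul]
  exact h _ ((H.subCl_smul_singleton_iff u).2 ha)

theorem agree_conj (H : IsIndepSystem G d) {X : Finset M} {s : G} (h : AgreeOn d X s 1) (u : G) :
    AgreeOn d (u • X) (u * s * u⁻¹) 1 := by
  apply H.agree_smul
  simpa using h.mul_left u

end IsIndepSystem

end Agree

end DimIndep

/-! ## Unbounded elements move almost maximally -/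

namespace DimIndep

open scoped Pointwise

section BasicOrbit

variable {G M : Type*} [DecidableEq M] [Group G] [MulAction G M] {d : Finset M → ℤ}

/-- Every type over a finite set `B` has a realisation which `g` moves to a conjugate independent
from it over `B`. -/
def MovesAlmostMaximally (d : Finset M → ℤ) (g : G) : Prop :=
  ∀ B C : Finset M, ∃ k : G, AgreeOn d B k 1 ∧ FinIndep d (k • C) B (g • k • C)

/-- No finite set `E` is such that `g` stabilises the closures of all finite sets containing `E`. -/
def IsUnbounded (d : Finset M → ℤ) (g : G) : Prop :=
  ∀ E : Finset M, ∃ B : Finset M, E ⊆ B ∧ ¬ SubCl d (g • B) B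

/-- `B` and `g • B` have equal finite dimension, so one inclusion between their closures forces
equality. -/
theorem IsIndepSystem.isUnbounded_inv (H : IsIndepSystem G d) {g : G} (hg : IsUnbounded d g) :
    IsUnbounded d g⁻¹ := fun E => by
  obtain ⟨B, hEB, hB⟩ := hg E
  refine ⟨B, hEB, fun h => hB ?_⟩
  unfold SubCl at *
  rw [← h, ← H.smul_eq g (B ∪ g⁻¹ • B), Finset.smul_finset_union, smul_inv_smul,
    Finset.union_comm]

/-- `D` is the orbit of a basic element over `A`, whose dimension over `A` is `δ`, and the closure
of `A ∪ D` is everything. -/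
structure IsGeneratingBasicOrbit (G : Type*) {M : Type*} [DecidableEq M] [Group G]
    [MulAction G M] (d : Finset M → ℤ) (A : Finset M) (D : Set M) (δ : ℤ) : Prop where
  pos : 0 < δ
  dim_insert : ∀ c ∈ D, ∀ C : Finset M, A ⊆ C → ¬ SubCl d {c} C → d (C ∪ {c}) = d C + δ
  dim_self : ∀ c ∈ D, d (A ∪ {c}) = d A + δ
  smul_mem : ∀ c ∈ D, ∀ k : G, AgreeOn d A k 1 → k • c ∈ D
  exists_smul : ∀ c ∈ D, ∀ c' ∈ D, ∃ k : G, AgreeOn d A k 1 ∧ k • c = c'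
  generates : ∀ m : M, ∃ X : Finset M, (X : Set M) ⊆ D ∧ SubCl d {m} (A ∪ X)

namespace IsGeneratingBasicOrbit

variable {A : Finset M} {D : Set M} {δ : ℤ}

theorem generates_finset (hD : IsGeneratingBasicOrbit G d A D δ) (H : IsIndepSystem G d)
    (Y : Finset M) :
    ∃ X : Finset M, (X : Set M) ⊆ D ∧ SubCl d Y (A ∪ X) := by
  induction Y using Finset.induction_on with
  | empty => exact ⟨∅, by simp, IsMonoSubmodular.subCl_of_subset (by simp)⟩
  | insert y Y _ ih =>
    obtain ⟨X, hX, hY⟩ := ih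
    obtain ⟨Z, hZ, hy⟩ := hD.generates y
    refine ⟨X ∪ Z, by simp [hX, hZ], ?_⟩
    rw [Finset.insert_eq]
    exact H.subCl_union (H.subCl_mono hy (by grind) subset_rfl)
      (H.subCl_mono hY (by grind) subset_rfl)

theorem dim_insert_le (hD : IsGeneratingBasicOrbit G d A D δ) {c : M} (hc : c ∈ D)
    {C : Finset M} (hC : A ⊆ C) : d (C ∪ {c}) ≤ d C + δ := by
  by_cases h : SubCl d {c} C
  · have := hD.pos
    unfold SubCl at h
    linarith
  · exact (hD.dim_insert c hc C hC h).le

theorem dim_union_le (hD : IsGeneratingBasicOrbit G d A D δ) {X : Finset M}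
    (hX : (X : Set M) ⊆ D) {C : Finset M} (hC : A ⊆ C) : d (C ∪ X) ≤ d C + δ * X.card := by
  induction X using Finset.induction_on with
  | empty => simp
  | insert x X hx ih =>
    rw [Finset.coe_insert, Set.insert_subset_iff] at hX
    have h1 := hD.dim_insert_le hX.1 (C := C ∪ X) (by grind)
    have h2 := ih hX.2
    rw [show C ∪ insert x X = C ∪ X ∪ {x} by grind, Finset.card_insert_of_notMem hx]
    push_cast
    linarith

/-- Outside the closure of `C`, the element `c` has dimension `δ` over `C` just as over `A`. With
Stationarity, this makes the elements of `D` outside that closure a single orbit over `C`. -/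
theorem finIndep_of_not_subCl (hD : IsGeneratingBasicOrbit G d A D δ) (H : IsIndepSystem G d)
    {c : M} (hc : c ∈ D) {C : Finset M} (hC : A ⊆ C) (h : ¬ SubCl d {c} C) :
    FinIndep d {c} A C := by
  apply H.finIndep_of_le
  have h1 := hD.dim_insert c hc C hC h
  have h2 := hD.dim_self c hc
  rw [show {c} ∪ A ∪ C = C ∪ {c} by grind, show A ∪ C = C by grind, Finset.union_comm {c} A]
  linarith

theorem exists_smul_over (hD : IsGeneratingBasicOrbit G d A D δ) (H : IsIndepSystem G d)
    {c c' : M} (hc : c ∈ D) (hc' : c' ∈ D) {C : Finset M} (hC : A ⊆ C) (h : ¬ SubCl d {c} C)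
    (h' : ¬ SubCl d {c'} C) : ∃ k : G, AgreeOn d C k 1 ∧ k • c = c' := by
  obtain ⟨k, hk, rfl⟩ := hD.exists_smul c hc c' hc'
  obtain ⟨l, hl, hl'⟩ := H.stationary {c} A C k hk (hD.finIndep_of_not_subCl H hc hC h)
    (by simpa using hD.finIndep_of_not_subCl H hc' hC h')
  exact ⟨l, hl, hl'.apply (by simp)⟩

theorem smul_finset_subset (hD : IsGeneratingBasicOrbit G d A D δ) {X : Finset M}
    (hX : (X : Set M) ⊆ D) {k : G} (hk : AgreeOn d A k 1) : ((k • X : Finset M) : Set M) ⊆ D := by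
  intro x hx
  rw [Finset.mem_coe, Finset.mem_smul_finset] at hx
  obtain ⟨y, hy, rfl⟩ := hx
  exact hD.smul_mem y (hX hy) k hk

/-- Otherwise `E` enlarges to some `F` for which `g` stabilises the closure of `F ∪ X` for every
finite `X ⊆ D`. For `B ⊇ F`, intersecting two such closures that are independent over `B` and
contain `B` shows that `g • B` lies in the closure of `B`, against unboundedness. -/
theorem exists_not_subCl_smul (hD : IsGeneratingBasicOrbit G d A D δ) (H : IsIndepSystem G d)
    {g : G} (hg : IsUnbounded d g) (E : Finset M) :
    ∃ c ∈ D, ¬ SubCl d {g • c} (E ∪ {c}) := by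
  by_contra! hE
  obtain ⟨Y, hYD, hY⟩ := hD.generates_finset H (E ∪ g • A)
  set F := A ∪ Y with hF
  have hEF : SubCl d E F := H.subCl_mono hY subset_rfl (by grind)
  have hgX : ∀ X : Finset M, (X : Set M) ⊆ D → SubCl d (g • X) (F ∪ X) := by
    intro X hX
    apply H.subCl_of_forall
    intro y hy
    obtain ⟨x, hx, rfl⟩ := Finset.mem_smul_finset.1 hy
    refine H.subCl_trans (hE x (hX hx)) ?_
    exact H.subCl_union_union hEF (IsMonoSubmodular.subCl_of_subset (by simpa using hx))
  have hgF : SubCl d (g • F) F := by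
    rw [hF, Finset.smul_finset_union, ← hF]
    refine H.subCl_union (H.subCl_mono hY subset_rfl (by grind)) ?_
    simpa [hF] using hgX Y hYD
  have hgFX : ∀ X : Finset M, (X : Set M) ⊆ D → SubCl d (g • (F ∪ X)) (F ∪ X) := by
    intro X hX
    rw [Finset.smul_finset_union]
    exact H.subCl_union (H.subCl_mono hgF (by grind) subset_rfl) (hgX X hX)
  obtain ⟨B, hFB, hB⟩ := hg F
  obtain ⟨X, hXD, hX⟩ := hD.generates_finset H B
  have hBX : SubCl d B (F ∪ X) := H.subCl_mono hX (by grind) subset_rfl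
  -- `F ∪ k • X` is the second set whose closure contains `B`, independent from `F ∪ X` over `B`.
  obtain ⟨k, hk, hkX⟩ := H.existence (F ∪ X) B (F ∪ X)
  have hkF : k • (F ∪ X) = F ∪ k • X := by
    rw [Finset.smul_finset_union, hk.smul_finset_self hFB]
  rw [hkF] at hkX
  have hkXD := hD.smul_finset_subset hXD (H.agree_mono hk (show A ⊆ B by grind))
  have hBkX : SubCl d B (F ∪ k • X) := by
    rw [← hkF, ← hk.smul_finset_self subset_rfl, H.subCl_smul_iff]
    exact hBX
  apply hB
  refine H.subCl_of_finIndep hkX ?_ ?_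
  · refine H.subCl_mono (H.subCl_trans ((H.subCl_smul_iff g).2 hBkX) (hgFX _ hkXD)) ?_ subset_rfl
    exact Finset.subset_union_right
  · refine H.subCl_mono (H.subCl_trans ((H.subCl_smul_iff g).2 hBX) (hgFX _ hXD)) ?_ subset_rfl
    exact Finset.subset_union_right

theorem exists_not_subCl (hD : IsGeneratingBasicOrbit G d A D δ) (H : IsIndepSystem G d)
    {g : G} (hg : IsUnbounded d g) (E : Finset M) :
    ∃ c ∈ D, ¬ SubCl d {c} E ∧ ¬ SubCl d {g • c} (E ∪ {c}) := by
  obtain ⟨c, hc, h⟩ := hD.exists_not_subCl_smul H hg (E ∪ g • E)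
  refine ⟨c, hc, fun hcE => h ?_, fun hcE => h (H.subCl_mono hcE (by grind) subset_rfl)⟩
  exact H.subCl_mono ((H.subCl_smul_singleton_iff g).2 hcE) (by grind) subset_rfl

theorem dim_smul_insert (hD : IsGeneratingBasicOrbit G d A D δ) (H : IsIndepSystem G d) (g : G)
    {c : M} (hc : c ∈ D) {C : Finset M} (hC : g • A ⊆ C) (h : ¬ SubCl d {g • c} C) :
    d (C ∪ {g • c}) = d C + δ := by
  have h1 := hD.dim_insert c hc (g⁻¹ • C) (Finset.smul_finset_subset_iff.1 hC)
    (by rwa [← H.subCl_smul_singleton_iff g, smul_inv_smul])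
  rw [← H.smul_eq g, Finset.smul_finset_union, smul_inv_smul, Finset.smul_finset_singleton,
    H.smul_eq] at h1
  exact h1

theorem dim_smul_union_le (hD : IsGeneratingBasicOrbit G d A D δ) (H : IsIndepSystem G d) (g : G)
    {X : Finset M} (hX : (X : Set M) ⊆ D) {C : Finset M} (hC : g • A ⊆ C) :
    d (C ∪ g • X) ≤ d C + δ * X.card := by
  have h1 := hD.dim_union_le hX (C := g⁻¹ • C) (Finset.smul_finset_subset_iff.1 hC)
  rwa [← H.smul_eq g, Finset.smul_finset_union, smul_inv_smul, H.smul_eq] at h1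

theorem exists_independent_subset (hD : IsGeneratingBasicOrbit G d A D δ)
    (H : IsIndepSystem G d) {X : Finset M} (hX : (X : Set M) ⊆ D) {E : Finset M} (hE : A ⊆ E) :
    ∃ Y : Finset M, (Y : Set M) ⊆ D ∧ SubCl d X (E ∪ Y) ∧ d (E ∪ Y) = d E + δ * Y.card := by
  induction X using Finset.induction_on with
  | empty => exact ⟨∅, by simp, IsMonoSubmodular.subCl_of_subset (by simp), by simp⟩
  | insert x X _ ih =>
    rw [Finset.coe_insert, Set.insert_subset_iff] at hX
    obtain ⟨Y, hYD, hY, hYd⟩ := ih hX.2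
    by_cases hx : SubCl d {x} (E ∪ Y)
    · exact ⟨Y, hYD, by rw [Finset.insert_eq]; exact H.subCl_union hx hY, hYd⟩
    · have hxY : x ∉ Y := fun h => hx (IsMonoSubmodular.subCl_of_subset (by simp [h]))
      refine ⟨insert x Y, ?_, ?_, ?_⟩
      · rw [Finset.coe_insert, Set.insert_subset_iff]
        exact ⟨hX.1, hYD⟩
      · rw [Finset.insert_eq x X]
        exact H.subCl_union (IsMonoSubmodular.subCl_of_subset (by grind))
          (H.subCl_mono hY (by grind) subset_rfl)
      · rw [show E ∪ insert x Y = E ∪ Y ∪ {x} by grind, Finset.card_insert_of_notMem hxY,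
          hD.dim_insert x hX.1 _ (by grind) hx, hYd]
        push_cast
        ring

/-- Independent tuples of elements of `D` are moved almost maximally. -/
theorem exists_dim_union_smul (hD : IsGeneratingBasicOrbit G d A D δ) (H : IsIndepSystem G d)
    {g : G} (hg : IsUnbounded d g) {F X : Finset M} (hAF : A ⊆ F) (hgAF : g • A ⊆ F)
    (hX : (X : Set M) ⊆ D) (hFX : d (F ∪ X) = d F + δ * X.card) :
    ∃ k : G, AgreeOn d F k 1 ∧ d (F ∪ k • X ∪ g • k • X) = d F + 2 * δ * X.card := by
  induction X using Finset.induction_on with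
  | empty => exact ⟨1, AgreeOn.refl _ _, by simp⟩
  | insert x X hx ih =>
    rw [Finset.coe_insert, Set.insert_subset_iff] at hX
    rw [show F ∪ insert x X = F ∪ X ∪ {x} by grind, Finset.card_insert_of_notMem hx] at hFX
    push_cast at hFX
    have h1 := hD.dim_insert_le hX.1 (C := F ∪ X) (by grind)
    have h2 := hD.dim_union_le hX.2 hAF
    have hFX' : d (F ∪ X) = d F + δ * X.card := by linarith
    have hxFX : ¬ SubCl d {x} (F ∪ X) := fun h => by
      have := hD.pos
      unfold SubCl at h
      linarith
    obtain ⟨k, hk, hkd⟩ := ih hX.2 hFX'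
    -- The part `k • X` is kept and `k • x` is replaced by `c`, so that `c` and `g • c` each add
    -- `δ`. The replacement is a move over `F ∪ k • X`, as neither `k • x` nor `c` lies in its
    -- closure.
    obtain ⟨c, hc, hcP, hgc⟩ := hD.exists_not_subCl H hg (F ∪ k • X ∪ g • k • X)
    have hkx : ¬ SubCl d {k • x} (F ∪ k • X) := by
      rwa [← hk.smul_finset_self subset_rfl, ← Finset.smul_finset_union,
        H.subCl_smul_singleton_iff]
    obtain ⟨l, hl, hlc⟩ := hD.exists_smul_over H (hD.smul_mem x hX.1 k (H.agree_mono hk hAF)) hc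
      (C := F ∪ k • X) (by grind) hkx
      (fun h => hcP (H.subCl_mono h (by grind) subset_rfl))
    refine ⟨l * k, (H.agree_mono hl (by grind)).mul_one hk, ?_⟩
    have hlk : (l * k) • insert x X = insert c (k • X) := by
      rw [Finset.insert_eq, Finset.smul_finset_union, Finset.smul_finset_singleton, mul_smul, hlc,
        mul_smul, hl.smul_finset_self (by grind)]
      rfl
    rw [hlk, Finset.card_insert_of_notMem hx]
    have h3 := hD.dim_insert c hc _ (by grind) hcP
    have h4 := hD.dim_smul_insert H g hc (by grind) hgc
    rw [show F ∪ insert c (k • X) ∪ g • insert c (k • X) =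
      F ∪ k • X ∪ g • k • X ∪ {c} ∪ {g • c} by
        rw [Finset.insert_eq, Finset.smul_finset_union, Finset.smul_finset_singleton]; grind]
    push_cast
    linarith

/-- Three successive moves make `C` independent from `E` over `B`, then from `F` over `E`, then from
its image under `g` over `F`; transitivity of independence composes them. The last two are performed
on an independent tuple `X` from `D` with `C` in the closure of `E ∪ X`. -/
theorem movesAlmostMaximally (hD : IsGeneratingBasicOrbit G d A D δ) (H : IsIndepSystem G d)
    {g : G} (hg : IsUnbounded d g) : MovesAlmostMaximally d g := by
  intro B C
  set E := A ∪ B with hE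
  set F := E ∪ g • E with hF
  obtain ⟨k₁, hk₁, hC₁⟩ := H.existence C B E
  obtain ⟨X₀, hX₀D, hX₀⟩ := hD.generates_finset H (k₁ • C)
  obtain ⟨X, hXD, hXX₀, hXd⟩ := hD.exists_independent_subset H hX₀D (E := E) (by grind)
  have hCX : SubCl d (k₁ • C) (E ∪ X) :=
    H.subCl_trans hX₀ (H.subCl_union (IsMonoSubmodular.subCl_of_subset (by grind)) hXX₀)
  obtain ⟨k₂, hk₂, hX₂⟩ := H.existence X E F
  have hX₂D := hD.smul_finset_subset hXD (H.agree_mono hk₂ (show A ⊆ E by grind))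
  have hX₂d : d (F ∪ k₂ • X) = d F + δ * (k₂ • X).card := by
    have h1 : d (k₂ • X ∪ E) = d (E ∪ X) := by
      conv_lhs => rw [← hk₂.smul_finset_self (subset_refl E)]
      rw [← Finset.smul_finset_union, H.smul_eq, Finset.union_comm]
    have h2 := hX₂
    unfold FinIndep at h2
    rw [show k₂ • X ∪ E ∪ F = F ∪ k₂ • X by grind, show E ∪ F = F by grind, h1] at h2
    rw [Finset.card_smul_finset]
    linarith
  obtain ⟨k₃, hk₃, hX₃⟩ := hD.exists_dim_union_smul H hg (F := F) (by grind)
    (by rw [hF, hE, Finset.smul_finset_union]; grind) hX₂D hX₂d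
  have hEF : E ⊆ F := by grind
  have hBE : B ⊆ E := by grind
  have hk₃E := H.agree_mono hk₃ hEF
  have hk₂₃ := hk₃E.mul_one hk₂
  have hkB := (H.agree_mono hk₂₃ hBE).mul_one hk₁
  refine ⟨k₃ * k₂ * k₁, hkB, ?_⟩
  set Z := k₃ • k₂ • X with hZ
  have hCZ : SubCl d ((k₃ * k₂ * k₁) • C) (E ∪ Z) := by
    have := (H.subCl_smul_iff (k₃ * k₂)).2 hCX
    rwa [Finset.smul_finset_union, hk₂₃.smul_finset_self subset_rfl, smul_smul, mul_smul k₃ k₂ X,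
      ← hZ] at this
  set C' := (k₃ * k₂ * k₁) • C with hC'
  have hBE' : FinIndep d C' B E := by
    have := (H.finIndep_smul_iff (k₃ * k₂)).2 hC₁
    rwa [hk₂₃.smul_finset_self hBE, hk₂₃.smul_finset_self subset_rfl, smul_smul, ← hC'] at this
  have hEF' : FinIndep d C' E F := by
    have := (H.finIndep_smul_iff k₃).2 hX₂
    rw [hk₃.smul_finset_self hEF, hk₃.smul_finset_self subset_rfl] at this
    exact H.finIndep_left this hCZ
  have hFg : FinIndep d C' F (g • C') := by
    have h1 : FinIndep d Z F (g • Z) := by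
      apply H.finIndep_of_le
      have h2 := hD.dim_smul_union_le H g (hD.smul_finset_subset hX₂D
        (H.agree_mono hk₃E (show A ⊆ E by grind))) (C := F)
        (by rw [hF, hE, Finset.smul_finset_union]; grind)
      have h3 : d (Z ∪ F) = d (F ∪ k₂ • X) := by
        conv_lhs => rw [hZ, ← hk₃.smul_finset_self (subset_refl F)]
        rw [← Finset.smul_finset_union, H.smul_eq, Finset.union_comm]
      rw [Finset.card_smul_finset] at h2
      rw [show Z ∪ F ∪ g • Z = F ∪ Z ∪ g • Z by grind, hX₃, h3, hX₂d]
      linarith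
    refine H.finIndep_left (H.finIndep_right h1 ?_)
      (H.subCl_mono hCZ (Finset.union_subset_union_left hEF) subset_rfl)
    have := (H.subCl_smul_iff g).2 hCZ
    rw [Finset.smul_finset_union] at this
    exact H.subCl_mono this (by grind) subset_rfl
  have h1 : FinIndep d C' E (F ∪ g • C') :=
    IsMonoSubmodular.finIndep_trans hEF' (by rwa [Finset.union_eq_right.2 hEF])
  have h2 : FinIndep d C' B (E ∪ (F ∪ g • C')) :=
    IsMonoSubmodular.finIndep_trans hBE' (by rwa [Finset.union_eq_right.2 hBE])
  exact H.finIndep_mono h2 (by grind) (by grind)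

end IsGeneratingBasicOrbit

end BasicOrbit

end DimIndep

/-! ## Products of four conjugates are locally dense -/

namespace DimIndep

open scoped Pointwise

section LocallyDense

variable {G M : Type*} [DecidableEq M] [Group G] [MulAction G M] {d : Finset M → ℤ}

theorem MovesAlmostMaximally.conj (H : IsIndepSystem G d) {g : G}
    (hg : MovesAlmostMaximally d g) (a : G) : MovesAlmostMaximally d (a⁻¹ * g * a) := by
  intro B C
  obtain ⟨k, hk, hC⟩ := hg (a • B) (a • C)
  refine ⟨a⁻¹ * k * a, ?_, ?_⟩
  · simpa using H.agree_conj hk a⁻¹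
  · rw [← H.finIndep_smul_iff a]
    simpa [smul_smul, mul_assoc] using hC

/-- Including `g⁻¹ • X` in `P` gives `g • z` independent from `X` over `g • X` after translation by
`g`. Almost maximal motion over `P` then supplies independence from `z`. -/
theorem MovesAlmostMaximally.exists_finIndep (H : IsIndepSystem G d) {g : G}
    (hg : MovesAlmostMaximally d g) {x X : Finset M} (hx : FinIndep d x X (g • X)) :
    ∃ k : G, AgreeOn d (X ∪ g • X) k 1 ∧ FinIndep d (g • k • x) (g • X) (X ∪ k • x) := by
  set P := X ∪ g • X ∪ g⁻¹ • X with hP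
  obtain ⟨k₁, hk₁, hx₁⟩ := H.existence x (X ∪ g • X) P
  obtain ⟨k₂, hk₂, hx₂⟩ := hg P (k₁ • x)
  have hk₂' : AgreeOn d (X ∪ g • X) k₂ 1 := H.agree_mono hk₂ (by grind)
  have hk := hk₂'.mul_one hk₁
  refine ⟨k₂ * k₁, hk, ?_⟩
  rw [smul_smul k₂ k₁ x] at hx₂
  set z := (k₂ * k₁) • x with hz
  have h1 : FinIndep d z X (g • X) := by
    have := (H.finIndep_smul_iff (k₂ * k₁)).2 hx
    rwa [hk.smul_finset_self (show X ⊆ _ by grind),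
      hk.smul_finset_self (show g • X ⊆ _ by grind)] at this
  have h2 : FinIndep d z (X ∪ g • X) P := by
    have := (H.finIndep_smul_iff k₂).2 hx₁
    rwa [hk₂.smul_finset_self subset_rfl, hk₂'.smul_finset_self subset_rfl, smul_smul] at this
  have h3 : FinIndep d z X P :=
    H.finIndep_mono (IsMonoSubmodular.finIndep_trans h1 h2) (by grind) (by grind)
  have h4 : FinIndep d z X (P ∪ g • z) :=
    IsMonoSubmodular.finIndep_trans h3
      (by rwa [Finset.union_eq_right.2 (show X ⊆ P by grind)])
  have h5 : FinIndep d z (X ∪ g • X) (g • z) :=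
    H.finIndep_base (H.finIndep_mono h4 (by grind) (by grind))
  have h6 : FinIndep d (g • z) (g • X) X := by
    have h7 : FinIndep d z X (g⁻¹ • X) := H.finIndep_mono h3 (by grind) (by grind)
    have := (H.finIndep_smul_iff g).2 h7
    rwa [smul_inv_smul] at this
  refine IsMonoSubmodular.finIndep_trans h6 ?_
  rw [Finset.union_comm]
  exact IsMonoSubmodular.finIndep_symm h5

namespace IsIndepSystem

theorem agree_conj_mul (H : IsIndepSystem G d) {X : Finset M} {g s a : G}
    (ha : AgreeOn d (s • X ∪ (g * s) • X) a 1) : AgreeOn d X (a⁻¹ * g * a * s) (g * s) := by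
  intro c hc
  have h1 := H.agree_mono ha Finset.subset_union_left _ ((H.subCl_smul_singleton_iff s).2 hc)
  have h2 := (H.agree_mono ha Finset.subset_union_right).inv_one _
    ((H.subCl_smul_singleton_iff (g * s)).2 hc)
  rw [one_smul] at h1 h2
  rw [mul_smul, mul_smul, h1, mul_smul, ← mul_smul g s c, h2]

/-- Two tuples in general position and of corresponding types are connected by a conjugate of an
element which moves almost maximally. -/
theorem exists_conj_agree (H : IsIndepSystem G d) {g : G} (hg : MovesAlmostMaximally d g)
    {X C : Finset M} {s t : G} (hst : AgreeOn d X (g * s) t)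
    (hx : FinIndep d (s • C) (s • X) (t • X))
    (hy : FinIndep d (t • C) (t • X) (s • X ∪ s • C)) :
    ∃ a : G, AgreeOn d (s • X ∪ t • X) a 1 ∧ AgreeOn d C (a⁻¹ * g * a * s) t := by
  have hgX : g • s • X = t • X := by rw [smul_smul, hst.smul_finset_eq subset_rfl]
  obtain ⟨k, hk, hkx⟩ := hg.exists_finIndep H (x := s • C) (X := s • X) (by rwa [hgX])
  rw [hgX] at hk hkx
  have hkX := H.agree_mono hk Finset.subset_union_left
  have hkY := H.agree_mono hk Finset.subset_union_right
  -- `h` fixes the closure of `t • X` and sends `k • t • C` to `g • k • s • C`. Both tuples are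
  -- independent from `s • X ∪ k • s • C` over `t • X`, so Stationarity replaces `h` by some `u`
  -- that also fixes this set; then `u * k` conjugates `g` as required.
  set h := g * k * s * t⁻¹ * k⁻¹ with hh
  have hhY : AgreeOn d (t • X) h 1 := by
    intro a ha
    have h1 := hkY.inv_one a ha
    have h2 : SubCl d {t⁻¹ • a} X := by
      rwa [← H.subCl_smul_singleton_iff t, smul_inv_smul]
    have h3 := hkX (s • t⁻¹ • a) ((H.subCl_smul_singleton_iff s).2 h2)
    have h4 := hst _ h2
    rw [one_smul] at h1 h3 ⊢
    rw [mul_smul] at h4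
    simp only [hh, mul_smul, h1, h3, h4, smul_inv_smul]
  have hky : FinIndep d (k • t • C) (t • X) (s • X ∪ k • s • C) := by
    have := (H.finIndep_smul_iff k).2 hy
    rwa [Finset.smul_finset_union, hkX.smul_finset_self subset_rfl,
      hkY.smul_finset_self subset_rfl] at this
  obtain ⟨u, hu, huh⟩ := H.stationary (k • t • C) (t • X) (t • X ∪ (s • X ∪ k • s • C)) h hhY
    (H.finIndep_mono hky (by grind) (by grind))
    (by
      have : h • k • t • C = g • k • s • C := by simp [hh, mul_smul]
      rw [this]
      exact H.finIndep_mono hkx (by grind) (by grind))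
  refine ⟨u * k, (H.agree_mono hu (by grind)).mul_one hk, ?_⟩
  intro c hc
  have h1 : u • k • s • c = k • s • c := by
    have := H.agree_mono hu (show k • s • C ⊆ _ by grind) (k • s • c)
      (by rwa [H.subCl_smul_singleton_iff, H.subCl_smul_singleton_iff])
    rwa [one_smul] at this
  have h2 : u • k • t • c = g • k • s • c := by
    have := H.agree_mono huh (show k • t • C ⊆ _ by grind) (k • t • c)
      (by rwa [H.subCl_smul_singleton_iff, H.subCl_smul_singleton_iff])
    rw [this]
    simp [hh, mul_smul]
  rw [mul_smul, mul_smul, mul_smul, mul_smul, h1, ← h2, ← mul_smul u k, inv_smul_smul]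

/-- Some conjugate makes the image of `C` independent from `C` over `Q`. Moving this image over `Q ∪
C` away from `W` only changes the conjugator. -/
theorem exists_conj_finIndep (H : IsIndepSystem G d) {g : G} (hg : MovesAlmostMaximally d g)
    (Q C W : Finset M) :
    ∃ a : G, AgreeOn d Q a 1 ∧ FinIndep d ((a⁻¹ * g * a) • C) Q W := by
  obtain ⟨k, hk, hC⟩ := hg Q C
  have hC' : FinIndep d C Q ((k⁻¹ * g * k) • C) := by
    rw [← H.finIndep_smul_iff k, hk.smul_finset_self subset_rfl]
    simpa [smul_smul, mul_assoc] using hC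
  obtain ⟨u, hu, huW⟩ := H.existence ((k⁻¹ * g * k) • C) (Q ∪ C) W
  refine ⟨k * u⁻¹, hk.mul_one (H.agree_mono hu (by grind)).inv_one, ?_⟩
  have huC : u⁻¹ • C = C := hu.inv_one.smul_finset_self (by grind)
  have h1 : FinIndep d (u • (k⁻¹ * g * k) • C) Q C := by
    have := (H.finIndep_smul_iff u).2 (IsMonoSubmodular.finIndep_symm hC')
    rwa [hu.smul_finset_self (show Q ⊆ _ by grind),
      hu.smul_finset_self (show C ⊆ _ by grind)] at this
  have h2 : ((k * u⁻¹)⁻¹ * g * (k * u⁻¹)) • C = u • (k⁻¹ * g * k) • C := by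
    conv_rhs => rw [← huC]
    simp only [smul_smul, mul_inv_rev, inv_inv, mul_assoc]
  rw [h2]
  exact H.finIndep_mono (IsMonoSubmodular.finIndep_trans h1 huW) (by grind) (by grind)

/-- The first of two successive moves, in general position. -/
theorem exists_conj_agree_finIndep (H : IsIndepSystem G d) {g : G}
    (hg : MovesAlmostMaximally d g) {X C W : Finset M} {s : G}
    (hW : FinIndep d (s • X) ((g * s) • X) W) :
    ∃ a : G, AgreeOn d (s • X ∪ (g * s) • X) a 1 ∧ AgreeOn d X (a⁻¹ * g * a * s) (g * s) ∧
      FinIndep d ((a⁻¹ * g * a * s) • C) ((g * s) • X) W := by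
  obtain ⟨a, ha, haW⟩ := H.exists_conj_finIndep hg (s • X ∪ (g * s) • X) (s • C) W
  refine ⟨a, ha, H.agree_conj_mul ha, ?_⟩
  rw [smul_smul, Finset.union_comm] at haW
  have := IsMonoSubmodular.finIndep_trans (IsMonoSubmodular.finIndep_symm hW)
    (IsMonoSubmodular.finIndep_symm haW)
  exact H.finIndep_mono (IsMonoSubmodular.finIndep_symm this) (by grind) (by grind)

/-- The outer factors `g₁` and `g₄⁻¹` are adjusted first, starting from `C` and from `v • C`, to
make their results generic with respect to the middle position of `X`. The inner factors `g₂` and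
`g₃⁻¹` then both lead to the same generic copy `t₂ • C`. -/
theorem exists_four_conj_agree (H : IsIndepSystem G d) {g₁ g₂ g₃ g₄ : G}
    (h₁ : MovesAlmostMaximally d g₁) (h₂ : MovesAlmostMaximally d g₂)
    (h₃ : MovesAlmostMaximally d g₃⁻¹) (h₄ : MovesAlmostMaximally d g₄⁻¹) {A X : Finset M}
    (hA₁ : A ⊆ g₁ • X) (hA₃ : A ⊆ (g₃ * (g₂ * g₁)) • X)
    (hX₁ : FinIndep d X (g₁ • X) ((g₂ * g₁) • X))
    (hX₃ : FinIndep d ((g₄ * (g₃ * (g₂ * g₁))) • X) ((g₃ * (g₂ * g₁)) • X) ((g₂ * g₁) • X))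
    {v : G} (hv : AgreeOn d X v (g₄ * (g₃ * (g₂ * g₁)))) (C : Finset M) :
    ∃ a₁ a₂ a₃ a₄ : G, AgreeOn d A a₁ 1 ∧ AgreeOn d A a₂ 1 ∧ AgreeOn d A a₃ 1 ∧ AgreeOn d A a₄ 1 ∧
      AgreeOn d C ((a₄⁻¹ * g₄ * a₄) * ((a₃⁻¹ * g₃ * a₃) * ((a₂⁻¹ * g₂ * a₂) * (a₁⁻¹ * g₁ * a₁))))
        v := by
  have hvX := hv.smul_finset_eq subset_rfl
  have hv₃ : AgreeOn d X (g₄⁻¹ * v) (g₃ * (g₂ * g₁)) := by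
    simpa using hv.mul_left g₄⁻¹
  obtain ⟨a₁, ha₁, ht₁, hx₁⟩ := H.exists_conj_agree_finIndep h₁ (s := 1) (C := C)
    (by simpa using hX₁)
  obtain ⟨a₄, ha₄, ht₃, hx₃⟩ := H.exists_conj_agree_finIndep h₄ (s := v) (C := C) (X := X)
    (W := (g₂ * g₁) • X) (by rwa [hv₃.smul_finset_eq subset_rfl, hvX])
  rw [mul_one, mul_one] at ht₁ hx₁
  rw [mul_one, one_smul] at ha₁
  rw [hv₃.smul_finset_eq subset_rfl] at ha₄ hx₃
  replace ht₃ := ht₃.trans hv₃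
  set t₁ := a₁⁻¹ * g₁ * a₁ with ht₁_def
  set t₃ := a₄⁻¹ * g₄⁻¹ * a₄ * v with ht₃_def
  have ht₁X := ht₁.smul_finset_eq subset_rfl
  have ht₃X := ht₃.smul_finset_eq subset_rfl
  obtain ⟨u, hu, hx₂⟩ := H.existence ((g₂ * g₁) • C) ((g₂ * g₁) • X)
    ((t₁ • X ∪ t₁ • C) ∪ (t₃ • X ∪ t₃ • C))
  have ht₂ : AgreeOn d X (u * (g₂ * g₁)) (g₂ * g₁) := by
    simpa using H.agree_mul_right hu
  rw [smul_smul] at hx₂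
  set t₂ := u * (g₂ * g₁) with ht₂_def
  have ht₂X := ht₂.smul_finset_eq subset_rfl
  obtain ⟨a₂, ha₂, hc₂⟩ := H.exists_conj_agree h₂ (X := X) (C := C) (s := t₁) (t := t₂)
    ((ht₁.mul_left g₂).trans ht₂.symm) (by rwa [ht₁X, ht₂X])
    (by rw [ht₂X]; exact H.finIndep_mono hx₂ (by grind) (by grind))
  obtain ⟨a₃, ha₃, hc₃⟩ := H.exists_conj_agree h₃ (X := X) (C := C) (s := t₃) (t := t₂)
    (by simpa using (ht₃.mul_left g₃⁻¹).trans (by simpa using ht₂.symm)) (by rwa [ht₃X, ht₂X])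
    (by rw [ht₂X]; exact H.finIndep_mono hx₂ (by grind) (by grind))
  rw [ht₁X] at ha₂
  rw [ht₃X] at ha₃
  refine ⟨a₁, a₂, a₃, a₄, H.agree_mono ha₁ (by grind), H.agree_mono ha₂ (by grind),
    H.agree_mono ha₃ (by grind), H.agree_mono ha₄ (by grind), fun c hc => ?_⟩
  have e₂ := hc₂ c hc
  have e₃ := hc₃ c hc
  rw [← ht₁_def, mul_smul (a₄⁻¹ * g₄ * a₄), mul_smul (a₃⁻¹ * g₃ * a₃), e₂, ← e₃, ht₃_def]
  simp only [← mul_smul]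
  congr 1
  group

end IsIndepSystem

/-- `v` agreeing with `v₀` on `X` are approximated by values of `φ` close to `h` on `A`. -/
def DenseAt {ι : Type*} (d : Finset M → ℤ) (φ : (ι → G) → G) (h : ι → G) (A : Finset M) (v₀ : G)
    (X : Finset M) : Prop :=
  ∀ v, AgreeOn d X v v₀ → ∀ C : Finset M,
    ∃ h' : ι → G, (∀ i, AgreeOn d A (h' i) (h i)) ∧ AgreeOn d C (φ h') v

/-- The image under `φ` of every nonempty open set is somewhere dense. -/
def LocallyDense {ι : Type*} (d : Finset M → ℤ) (φ : (ι → G) → G) : Prop :=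
  ∀ (h : ι → G) (A : Finset M), ∃ (h₀ : ι → G) (X : Finset M),
    (∀ i, AgreeOn d A (h₀ i) (h i)) ∧ DenseAt d φ h A (φ h₀) X

/-- `φ` is continuous for agreement on closures of finite sets. -/
def AgreeContinuous {ι : Type*} (d : Finset M → ℤ) (φ : (ι → G) → G) : Prop :=
  ∀ (h : ι → G) (C : Finset M), ∃ A : Finset M, ∀ h' : ι → G,
    (∀ i, AgreeOn d A (h' i) (h i)) → AgreeOn d C (φ h') (φ h)

/-- The product of four conjugates of `g`. -/
def fourConj (g : G) (h : Fin 4 → G) : G :=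
  ((h 3)⁻¹ * g * h 3) * (((h 2)⁻¹ * g * h 2) * (((h 1)⁻¹ * g * h 1) * ((h 0)⁻¹ * g * h 0)))

theorem locallyDense_fourConj (H : IsIndepSystem G d) {g : G} (hg : MovesAlmostMaximally d g)
    (hg' : MovesAlmostMaximally d g⁻¹) : LocallyDense d (fourConj g) := by
  intro h A
  have hm : ∀ a : G, MovesAlmostMaximally d (a⁻¹ * g * a) := fun a => hg.conj H a
  have hm' : ∀ a : G, MovesAlmostMaximally d (a⁻¹ * g * a)⁻¹ := fun a => by
    have := hg'.conj H a
    rwa [show a⁻¹ * g⁻¹ * a = (a⁻¹ * g * a)⁻¹ by group] at this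
  set g₂ := (h 1)⁻¹ * g * h 1 with hg₂
  set g₃ := (h 2)⁻¹ * g * h 2 with hg₃
  -- `X₂` is the middle position of the chain, chosen so that both neighbouring positions contain
  -- `A`. The corrections `c₁` and `c₄` fix those positions, so they leave the conjugators unchanged
  -- on `A`.
  set X₂ := g₂ • A ∪ g₃⁻¹ • A with hX₂
  have hA₁ : A ⊆ g₂⁻¹ • X₂ := by
    rw [hX₂, Finset.smul_finset_union, inv_smul_smul]; grind
  have hA₃ : A ⊆ g₃ • X₂ := by
    rw [hX₂, Finset.smul_finset_union, smul_inv_smul]; grind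
  obtain ⟨c₁, hc₁, hX₁⟩ := H.existence (((h 0)⁻¹ * g * h 0)⁻¹ • g₂⁻¹ • X₂) (g₂⁻¹ • X₂) X₂
  obtain ⟨c₄, hc₄, hX₃⟩ := H.existence (((h 3)⁻¹ * g * h 3) • g₃ • X₂) (g₃ • X₂) X₂
  set g₁ := (h 0 * c₁⁻¹)⁻¹ * g * (h 0 * c₁⁻¹) with hg₁
  set g₄ := (h 3 * c₄⁻¹)⁻¹ * g * (h 3 * c₄⁻¹) with hg₄
  have hX₁' : c₁ • ((h 0)⁻¹ * g * h 0)⁻¹ • g₂⁻¹ • X₂ = g₁⁻¹ • g₂⁻¹ • X₂ := by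
    conv_lhs => rw [← hc₁.inv_one.smul_finset_self (subset_refl (g₂⁻¹ • X₂))]
    simp only [hg₁, smul_smul, mul_inv_rev, inv_inv, mul_assoc]
  have hX₃' : c₄ • ((h 3)⁻¹ * g * h 3) • g₃ • X₂ = g₄ • g₃ • X₂ := by
    conv_lhs => rw [← hc₄.inv_one.smul_finset_self (subset_refl (g₃ • X₂))]
    simp only [hg₄, smul_smul, mul_inv_rev, inv_inv, mul_assoc]
  rw [hX₁'] at hX₁
  rw [hX₃'] at hX₃
  set X := g₁⁻¹ • g₂⁻¹ • X₂ with hX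
  have e₁ : g₁ • X = g₂⁻¹ • X₂ := by rw [hX, smul_inv_smul]
  have e₂ : (g₂ * g₁) • X = X₂ := by rw [mul_smul, e₁, smul_inv_smul]
  have e₃ : (g₃ * (g₂ * g₁)) • X = g₃ • X₂ := by rw [mul_smul, e₂]
  have e₄ : (g₄ * (g₃ * (g₂ * g₁))) • X = g₄ • g₃ • X₂ := by rw [mul_smul, e₃]
  have hc₁A := (H.agree_mono hc₁ hA₁).inv_one
  have hc₄A := (H.agree_mono hc₄ hA₃).inv_one
  refine ⟨![h 0 * c₁⁻¹, h 1, h 2, h 3 * c₄⁻¹], X, ?_, ?_⟩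
  · intro i
    fin_cases i
    · simpa using hc₁A.mul_left (h 0)
    · exact AgreeOn.refl _ _
    · exact AgreeOn.refl _ _
    · simpa using hc₄A.mul_left (h 3)
  · intro v hv C
    obtain ⟨a₁, a₂, a₃, a₄, ha₁, ha₂, ha₃, ha₄, hC⟩ := H.exists_four_conj_agree (hm (h 0 * c₁⁻¹))
      (hm (h 1)) (hm' (h 2)) (hm' (h 3 * c₄⁻¹)) (A := A) (X := X) (by rwa [e₁]) (by rwa [e₃])
      (by rwa [e₁, e₂]) (by rwa [e₂, e₃, e₄]) (v := v) hv C
    refine ⟨![h 0 * (c₁⁻¹ * a₁), h 1 * a₂, h 2 * a₃, h 3 * (c₄⁻¹ * a₄)], ?_, ?_⟩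
    · intro i
      fin_cases i
      · simpa using (hc₁A.mul_one ha₁).mul_left (h 0)
      · simpa using ha₂.mul_left (h 1)
      · simpa using ha₃.mul_left (h 2)
      · simpa using (hc₄A.mul_one ha₄).mul_left (h 3)
    · convert hC using 1
      simp [fourConj, mul_assoc]

end LocallyDense

end DimIndep

/-! ## Every element is a quotient of two products of four conjugates -/

namespace DimIndep

open scoped Pointwise

section Game

variable {G M ι : Type*} [DecidableEq M] [Group G] [MulAction G M] {d : Finset M → ℤ}

theorem AgreeContinuous.mul (H : IsIndepSystem G d) {φ ψ : (ι → G) → G}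
    (hφ : AgreeContinuous d φ) (hψ : AgreeContinuous d ψ) :
    AgreeContinuous d fun h => φ h * ψ h := by
  intro h C
  obtain ⟨A, hA⟩ := hψ h C
  obtain ⟨B, hB⟩ := hφ h (ψ h • C)
  refine ⟨A ∪ B, fun h' hh => ?_⟩
  have h1 := hA h' fun i => H.agree_mono (hh i) Finset.subset_union_left
  have h2 := hB h' fun i => H.agree_mono (hh i) Finset.subset_union_right
  exact (h1.mul_left (φ h')).trans (H.agree_mul_right h2)

theorem AgreeContinuous.inv (H : IsIndepSystem G d) {φ : (ι → G) → G}
    (hφ : AgreeContinuous d φ) : AgreeContinuous d fun h => (φ h)⁻¹ := by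
  intro h C
  obtain ⟨A, hA⟩ := hφ h ((φ h)⁻¹ • C)
  refine ⟨A, fun h' hh => ?_⟩
  have h1 := (H.agree_mul_right (hA h' hh)).mul_left (φ h')⁻¹
  simpa using h1.symm

theorem agreeContinuous_const (g : G) : AgreeContinuous d fun _ : ι → G => g :=
  fun _ _ => ⟨∅, fun _ _ => AgreeOn.refl _ _⟩

theorem agreeContinuous_apply (i : ι) : AgreeContinuous d fun h : ι → G => h i :=
  fun _ C => ⟨C, fun _ hh => hh i⟩

theorem agreeContinuous_fourConj (H : IsIndepSystem G d) (g : G) :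
    AgreeContinuous d (fourConj g) := by
  have hc : ∀ i : Fin 4, AgreeContinuous d fun h : Fin 4 → G => (h i)⁻¹ * g * h i := fun i =>
    (((agreeContinuous_apply i).inv H).mul H (agreeContinuous_const g)).mul H
      (agreeContinuous_apply i)
  exact (hc 3).mul H ((hc 2).mul H ((hc 1).mul H (hc 0)))

theorem DenseAt.mono (H : IsIndepSystem G d) {φ : (ι → G) → G} {h : ι → G} {A X X' : Finset M}
    {v v' : G} (hφ : DenseAt d φ h A v X) (hX : X ⊆ X') (hv : AgreeOn d X v' v) :
    DenseAt d φ h A v' X' :=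
  fun u hu => hφ u ((H.agree_mono hu hX).trans hv)

theorem DenseAt.const_mul {φ : (ι → G) → G} {h : ι → G} {A X : Finset M} {v : G}
    (hφ : DenseAt d φ h A v X) (f : G) : DenseAt d (fun h => f * φ h) h A (f * v) X := by
  intro u hu C
  obtain ⟨h', hh', hC⟩ := hφ (f⁻¹ * u) (by simpa using hu.mul_left f⁻¹) C
  exact ⟨h', hh', by simpa using hC.mul_left f⟩

theorem LocallyDense.const_mul {φ : (ι → G) → G} (hφ : LocallyDense d φ) (f : G) :
    LocallyDense d fun h => f * φ h := by
  intro h A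
  obtain ⟨h₀, X, hh₀, hX⟩ := hφ h A
  exact ⟨h₀, X, hh₀, hX.const_mul f⟩

/-- Shrinking a nonempty open set on which `φ` is dense at `v`, so that it is mapped into the
neighbourhood of `v` given by `X`. -/
theorem DenseAt.exists_shrink [Fintype ι] (H : IsIndepSystem G d) {φ : (ι → G) → G}
    (hφ : LocallyDense d φ) (hc : AgreeContinuous d φ) {h : ι → G} {A X : Finset M} {v : G}
    (hd : DenseAt d φ h A v X) (m : M) :
    ∃ (h₁ : ι → G) (A₁ : Finset M) (v₁ : G) (X₁ : Finset M), DenseAt d φ h₁ A₁ v₁ X₁ ∧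
      (∀ i, AgreeOn d A (h₁ i) (h i)) ∧ A ⊆ A₁ ∧ m ∈ A₁ ∧ (∀ i, (h₁ i)⁻¹ • m ∈ A₁) ∧
      X ⊆ X₁ ∧ AgreeOn d X v₁ v ∧
      ∀ h' : ι → G, (∀ i, AgreeOn d A₁ (h' i) (h₁ i)) → AgreeOn d X (φ h') v := by
  obtain ⟨h₁, hh₁, hv⟩ := hd v (AgreeOn.refl _ _) X
  obtain ⟨B, hB⟩ := hc h₁ X
  -- `B` controls the values on `X` by continuity; `m` and its preimages are included so that the
  -- limits are defined everywhere and surjective.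
  set A₁ := A ∪ {m} ∪ B ∪ Finset.univ.image (fun i => (h₁ i)⁻¹ • m) with hA₁
  obtain ⟨h₂, X₂, hh₂, hX₂⟩ := hφ h₁ A₁
  have hX : ∀ h' : ι → G, (∀ i, AgreeOn d A₁ (h' i) (h₁ i)) → AgreeOn d X (φ h') v := fun h' hh' =>
    (hB h' fun i => H.agree_mono (hh' i) (by grind)).trans hv
  refine ⟨h₁, A₁, φ h₂, X ∪ X₂, hX₂.mono H (by grind) (AgreeOn.refl _ _), hh₁, by grind, by grind,
    fun i => ?_, by grind, hX h₂ hh₂, hX⟩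
  exact Finset.mem_union_right _ (Finset.mem_image_of_mem _ (Finset.mem_univ i))

/-- A pair of nonempty open sets, with an open set in which both `φ` and `ψ` have dense image. -/
structure GameState (d : Finset M → ℤ) (φ ψ : (ι → G) → G) where
  left : ι → G
  leftSet : Finset M
  right : ι → G
  rightSet : Finset M
  value : G
  valueSet : Finset M
  denseAt_left : DenseAt d φ left leftSet value valueSet
  denseAt_right : DenseAt d ψ right rightSet value valueSet

/-- One round of the game, which decides the values at `m`. -/
structure GameState.Next {φ ψ : (ι → G) → G} (m : M) (S T : GameState d φ ψ) : Prop where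
  left_agree : ∀ i, AgreeOn d S.leftSet (T.left i) (S.left i)
  right_agree : ∀ i, AgreeOn d S.rightSet (T.right i) (S.right i)
  left_subset : S.leftSet ⊆ T.leftSet
  right_subset : S.rightSet ⊆ T.rightSet
  left_mem : m ∈ T.leftSet
  right_mem : m ∈ T.rightSet
  left_inv_mem : ∀ i, (T.left i)⁻¹ • m ∈ T.leftSet
  right_inv_mem : ∀ i, (T.right i)⁻¹ • m ∈ T.rightSet
  left_value : ∀ h, (∀ i, AgreeOn d T.leftSet (h i) (T.left i)) → φ h • m = S.value • m
  right_value : ∀ h, (∀ i, AgreeOn d T.rightSet (h i) (T.right i)) → ψ h • m = S.value • m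

theorem GameState.exists_next [Fintype ι] (H : IsIndepSystem G d) {φ ψ : (ι → G) → G}
    (hφ : LocallyDense d φ) (hφc : AgreeContinuous d φ) (hψ : LocallyDense d ψ)
    (hψc : AgreeContinuous d ψ) (m : M) (S : GameState d φ ψ) :
    ∃ T : GameState d φ ψ, S.Next m T := by
  have hS := S.denseAt_left.mono H (X' := S.valueSet ∪ {m}) (by grind) (AgreeOn.refl _ _)
  obtain ⟨h₁, A₁, v₁, X₁, hd₁, hA, hAA₁, hm₁, hi₁, hX₁, hv₁, hval₁⟩ := hS.exists_shrink H hφ hφc m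
  -- The right-hand map is treated inside the open set left by the left-hand one, so density of both
  -- survives the round.
  have hS' := S.denseAt_right.mono H (X' := X₁) (by grind) (H.agree_mono hv₁ (by grind))
  obtain ⟨h₂, A₂, v₂, X₂, hd₂, hB, hBA₂, hm₂, hi₂, hX₂, hv₂, hval₂⟩ := hS'.exists_shrink H hψ hψc m
  refine ⟨⟨h₁, A₁, h₂, A₂, v₂, X₂, hd₁.mono H hX₂ hv₂, hd₂⟩,
    ⟨hA, hB, hAA₁, hBA₂, hm₁, hm₂, hi₁, hi₂, fun h hh => ?_, fun h hh => ?_⟩⟩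
  · exact (hval₁ h hh).apply (by grind)
  · rw [(hval₂ h hh).apply (hX₁ (by grind)), hv₁.apply (by grind)]

theorem GameState.exists_eq [Countable M] [Fintype ι] (H : IsIndepSystem G d)
    {φ ψ : (ι → G) → G} (hφ : LocallyDense d φ) (hφc : AgreeContinuous d φ)
    (hψ : LocallyDense d ψ) (hψc : AgreeContinuous d ψ) (S : GameState d φ ψ) :
    ∃ h k, φ h = ψ k := by
  rcases isEmpty_or_nonempty M with hM | hM
  · exact ⟨S.left, S.right, H.faithful _ _ fun m => isEmptyElim m⟩
  obtain ⟨e, he⟩ := exists_surjective_nat M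
  choose next hnext using GameState.exists_next H hφ hφc hψ hψc
  let T : ℕ → GameState d φ ψ := fun n => Nat.rec S (fun k U => next (e k) U) n
  have hT : ∀ n, (T n).Next (e n) (T (n + 1)) := fun n => hnext (e n) (T n)
  have hL : ∀ i, ∃ t : G, ∀ n, AgreeOn d (T n).leftSet t ((T n).left i) := fun i => by
    refine H.complete (fun n => (T n).leftSet) (fun n => (T n).left i)
      (fun n => (hT n).left_subset) (fun m => ?_) (fun m => ?_) fun n => (hT n).left_agree i
    · obtain ⟨n, rfl⟩ := he m
      exact ⟨n + 1, (hT n).left_mem⟩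
    · obtain ⟨n, rfl⟩ := he m
      exact ⟨n + 1, (hT n).left_inv_mem i⟩
  have hR : ∀ i, ∃ t : G, ∀ n, AgreeOn d (T n).rightSet t ((T n).right i) := fun i => by
    refine H.complete (fun n => (T n).rightSet) (fun n => (T n).right i)
      (fun n => (hT n).right_subset) (fun m => ?_) (fun m => ?_) fun n => (hT n).right_agree i
    · obtain ⟨n, rfl⟩ := he m
      exact ⟨n + 1, (hT n).right_mem⟩
    · obtain ⟨n, rfl⟩ := he m
      exact ⟨n + 1, (hT n).right_inv_mem i⟩
  choose h hh using hL
  choose k hk using hR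
  refine ⟨h, k, H.faithful _ _ fun m => ?_⟩
  obtain ⟨n, rfl⟩ := he m
  rw [(hT n).left_value h fun i => hh i (n + 1), (hT n).right_value k fun i => hk i (n + 1)]

/-- The conjugation action of `G` on itself is topologically transitive. -/
theorem IsIndepSystem.exists_conj_agree_agree (H : IsIndepSystem G d) (v w : G)
    (X Y : Finset M) :
    ∃ c u : G, AgreeOn d (c • X) u (c * v * c⁻¹) ∧ AgreeOn d Y u w := by
  -- Once `X` and its image under `v` are moved away from `Y` and its image under `w`, the two
  -- prescriptions do not interact and Stationarity over the empty set amalgamates them.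
  obtain ⟨c, -, hc⟩ := H.existence (X ∪ v • X) ∅ (Y ∪ w • Y)
  have h1 : FinIndep d (w • c • X) ∅ (w • Y) := by
    have := (H.finIndep_smul_iff w (A := c • X) (B := ∅) (C := Y)).2
      (H.finIndep_mono hc (by rw [Finset.smul_finset_union]; grind) (by grind))
    simpa using this
  have h2 : FinIndep d ((c * v * c⁻¹ * w⁻¹) • w • c • X) ∅ (w • Y) := by
    have : (c * v * c⁻¹ * w⁻¹) • w • c • X = c • v • X := by simp [mul_smul]
    rw [this]
    exact H.finIndep_mono hc (by rw [Finset.smul_finset_union]; grind) (by grind)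
  obtain ⟨k, hk, hk'⟩ := H.stationary _ _ _ (c * v * c⁻¹ * w⁻¹) (H.agree_empty _ _) h1 h2
  refine ⟨c, k * w, ?_, ?_⟩
  · have := H.agree_mul_right (H.agree_mono hk' (show w • c • X ⊆ _ by grind))
    simpa using this
  · simpa using H.agree_mul_right hk

theorem exists_fourConj_eq_mul_fourConj [Countable M] (H : IsIndepSystem G d) {g : G}
    (hg : MovesAlmostMaximally d g) (hg' : MovesAlmostMaximally d g⁻¹) (f : G) :
    ∃ h k : Fin 4 → G, fourConj g h = f * fourConj g k := by
  have hφ := locallyDense_fourConj H hg hg'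
  have hφc := agreeContinuous_fourConj H (d := d) g
  obtain ⟨h₀, X, -, hX⟩ := hφ 1 ∅
  -- `u` lies both in a conjugate of the open set where `fourConj g` is dense and in the left
  -- translate of that set by `f`; it is the initial value of the game.
  obtain ⟨c, u, hu, hu'⟩ := H.exists_conj_agree_agree (fourConj g h₀) (f * fourConj g h₀) X X
  have hconj : ∀ h, fourConj g (fun i => h i * c⁻¹) = c * fourConj g h * c⁻¹ := fun h => by
    simp [fourConj, mul_assoc]
  have hX' : DenseAt d (fourConj g) 1 ∅ (c * fourConj g h₀ * c⁻¹) (c • X) := by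
    intro v hv C
    obtain ⟨h, -, hh⟩ := hX (c⁻¹ * v * c)
      (by simpa [mul_assoc] using (H.agree_mul_right hv).mul_left c⁻¹) (c⁻¹ • C)
    refine ⟨fun i => h i * c⁻¹, fun i => H.agree_empty _ _, ?_⟩
    rw [hconj]
    simpa [mul_assoc] using (H.agree_mul_right hh).mul_left c
  exact GameState.exists_eq H hφ hφc (hφ.const_mul f) ((agreeContinuous_const f).mul H hφc)
    ⟨1, ∅, 1, ∅, u, c • X ∪ X, hX'.mono H (by grind) hu,
      (hX.const_mul f).mono H (by grind) hu'⟩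

theorem exists_list_isConj (g : G) {f : G} {h k : Fin 4 → G}
    (hf : fourConj g h = f * fourConj g k) :
    ∃ l : List G, l.length = 96 ∧ (∀ x ∈ l, IsConj g x ∨ IsConj g⁻¹ x) ∧ l.prod = f := by
  have hc : ∀ a b : G, IsConj a (b⁻¹ * a * b) := fun a b => isConj_iff.2 ⟨b⁻¹, by group⟩
  have hl : ∀ n : ℕ, ∃ l : List G, l.length = 2 * n ∧
      (∀ x ∈ l, IsConj g x ∨ IsConj g⁻¹ x) ∧ l.prod = 1 := by
    intro n
    induction n with
    | zero => exact ⟨[], by simp⟩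
    | succ n ih =>
      obtain ⟨l, hl, hx, hp⟩ := ih
      refine ⟨g :: g⁻¹ :: l, by simp [hl]; ring, ?_, by simp [hp]⟩
      simp only [List.mem_cons, forall_eq_or_imp]
      exact ⟨.inl (IsConj.refl _), .inr (IsConj.refl _), hx⟩
  -- Eight conjugates already suffice, and `8 + 2 * 44 = 96`.
  obtain ⟨l, hl, hx, hp⟩ := hl 44
  refine ⟨((h 3)⁻¹ * g * h 3) :: ((h 2)⁻¹ * g * h 2) :: ((h 1)⁻¹ * g * h 1) ::
    ((h 0)⁻¹ * g * h 0) :: ((k 0)⁻¹ * g⁻¹ * k 0) :: ((k 1)⁻¹ * g⁻¹ * k 1) ::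
    ((k 2)⁻¹ * g⁻¹ * k 2) :: ((k 3)⁻¹ * g⁻¹ * k 3) :: l, by simp [hl], ?_, ?_⟩
  · simp only [List.mem_cons, forall_eq_or_imp]
    exact ⟨.inl (hc _ _), .inl (hc _ _), .inl (hc _ _), .inl (hc _ _), .inr (hc _ _),
      .inr (hc _ _), .inr (hc _ _), .inr (hc _ _), hx⟩
  · simp only [List.prod_cons, hp]
    rw [eq_mul_inv_of_mul_eq hf.symm]
    simp [fourConj, mul_assoc]

end Game

end DimIndep

/-! ## The independence system of a dimension function -/

namespace DimIndep

open scoped Pointwise FirstOrder Classical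

section Closure

variable {M : Type*} {d : Finset M → ℤ}

/-- By submodularity a larger base can only lower the relative dimension, so a finite `B` whose
closure contains `Z` attains the minimum. -/
theorem IsMonoSubmodular.relDim_eq (hd : IsMonoSubmodular d) (X : Finset M) {B : Finset M}
    {Z : Set M} (hB : (B : Set M) ⊆ Z) (hZ : ∀ z ∈ Z, SubCl d {z} B) :
    relDim d X Z = d (X ∪ B) - d B := by
  refine IsLeast.csInf_eq ⟨⟨B, hB, rfl⟩, ?_⟩
  rintro _ ⟨Y, hY, rfl⟩
  have h1 : SubCl d Y B := hd.subCl_of_forall fun y hy => hZ y (hY hy)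
  have h2 := hd.submod_of_subset (U := X ∪ B) (Z := Y) (X := X ∪ Y) (Y := B ∪ Y)
    (by grind) (by grind) (by grind)
  unfold SubCl at h1
  linarith

theorem IsMonoSubmodular.mem_dClosure_iff (hd : IsMonoSubmodular d) {a : M} {B : Finset M} :
    a ∈ dClosure d (B : Set M) ↔ SubCl d {a} B := by
  unfold dClosure SubCl
  rw [Set.mem_ofPred_eq, hd.relDim_eq {a} subset_rfl
    fun z hz => IsMonoSubmodular.subCl_of_subset (by simpa using hz), Finset.union_comm,
        sub_eq_zero]

theorem IsMonoSubmodular.subset_dClosure (hd : IsMonoSubmodular d) (B : Finset M) :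
    (B : Set M) ⊆ dClosure d (B : Set M) :=
  fun _ hb => hd.mem_dClosure_iff.2 (IsMonoSubmodular.subCl_of_subset (by simpa using hb))

theorem IsMonoSubmodular.dClosure_subset_iff (hd : IsMonoSubmodular d) {A B : Finset M} :
    dClosure d (A : Set M) ⊆ dClosure d (B : Set M) ↔ SubCl d A B := by
  refine ⟨fun h => hd.subCl_of_forall fun a ha => ?_, fun h a ha => ?_⟩
  · exact hd.mem_dClosure_iff.1 (h (hd.subset_dClosure A ha))
  · rw [hd.mem_dClosure_iff] at ha ⊢
    exact hd.subCl_trans ha h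

theorem IsMonoSubmodular.setDim_eq (hd : IsMonoSubmodular d) (A : Finset M) {B : Finset M}
    {Z : Set M} (hB : (B : Set M) ⊆ Z) (hZ : ∀ z ∈ Z, SubCl d {z} B) :
    setDim d (dClosure d (A : Set M)) Z = d (A ∪ B) - d B := by
  refine IsGreatest.csSup_eq ⟨⟨A, hd.subset_dClosure A, (hd.relDim_eq A hB hZ).symm⟩, ?_⟩
  rintro _ ⟨X, hX, rfl⟩
  rw [hd.relDim_eq X hB hZ]
  have h1 : SubCl d X A := hd.subCl_of_forall fun x hx => hd.mem_dClosure_iff.1 (hX hx)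
  have h2 : SubCl d X (A ∪ B) := hd.subCl_mono h1 (by grind) subset_rfl
  have h3 := hd.mono (show X ∪ B ⊆ A ∪ B ∪ X by grind)
  unfold SubCl at h2
  linarith

theorem IsMonoSubmodular.indep_dClosure_iff (hd : IsMonoSubmodular d) (A B C : Finset M) :
    Indep d (dClosure d (A : Set M)) (dClosure d (B : Set M)) (dClosure d (C : Set M)) ↔
      FinIndep d A B C := by
  unfold Indep FinIndep
  rw [hd.setDim_eq A (B := B ∪ C), hd.setDim_eq A (hd.subset_dClosure B)
    fun z hz => hd.mem_dClosure_iff.1 hz, Finset.union_assoc]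
  · constructor <;> intro h <;> linarith
  · rw [Finset.coe_union]
    exact Set.union_subset_union (hd.subset_dClosure B) (hd.subset_dClosure C)
  · rintro z (hz | hz)
    · exact hd.subCl_mono (hd.mem_dClosure_iff.1 hz) (by grind) subset_rfl
    · exact hd.subCl_mono (hd.mem_dClosure_iff.1 hz) (by grind) subset_rfl

end Closure

section Automorphisms

variable {L : FirstOrder.Language} {M : Type*} [L.Structure M] {d : Finset M → ℤ}

/-- Automorphisms act on the structure by evaluation. -/
instance autMulAction (L : FirstOrder.Language) (M : Type*) [L.Structure M] :
    MulAction (M ≃[L] M) M where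
  smul f m := f m
  one_smul _ := rfl
  mul_smul _ _ _ := rfl

theorem IsDimensionFunction.isMonoSubmodular (hd : IsDimensionFunction L d) :
    IsMonoSubmodular d where
  mono {X Y} h := by
    have := hd.mono X Y
    rwa [Finset.union_eq_right.2 h] at this
  submod X Y := by
    have := hd.submodular X Y
    linarith

theorem IsDimensionFunction.subCl_image_iff (hd : IsDimensionFunction L d) (f : M ≃[L] M)
    {X Y : Finset M} : SubCl d (Y.image f) (X.image f) ↔ SubCl d Y X := by
  unfold SubCl
  rw [← Finset.image_union, hd.invariant, hd.invariant]

theorem IsDimensionFunction.image_dClosure (hd : IsDimensionFunction L d) (f : M ≃[L] M)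
    (X : Finset M) :
    f '' dClosure d (X : Set M) = dClosure d ((X.image f : Finset M) : Set M) := by
  have hm := hd.isMonoSubmodular
  ext a
  constructor
  · rintro ⟨b, hb, rfl⟩
    rw [hm.mem_dClosure_iff] at hb ⊢
    rwa [← Finset.image_singleton, hd.subCl_image_iff]
  · intro ha
    obtain ⟨b, rfl⟩ := f.surjective a
    refine ⟨b, ?_, rfl⟩
    rw [hm.mem_dClosure_iff] at ha ⊢
    rwa [← Finset.image_singleton, hd.subCl_image_iff] at ha

theorem autFix_mono {X Y : Set M} (h : X ⊆ Y) : autFix L Y ≤ autFix L X :=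
  fun _ hf x hx => hf x (h hx)

theorem IsMonoSubmodular.dClosure_empty_subset (hd : IsMonoSubmodular d) (X : Finset M) :
    dClosure d (∅ : Set M) ⊆ dClosure d (X : Set M) := by
  rw [← Finset.coe_empty]
  exact hd.dClosure_subset_iff.2 (IsMonoSubmodular.subCl_of_subset (Finset.empty_subset _))

theorem IsMonoSubmodular.agreeOn_one_iff (hd : IsMonoSubmodular d)
    {g : autFix L (dClosure d (∅ : Set M))} {X : Finset M} :
    AgreeOn d X g 1 ↔ (g : M ≃[L] M) ∈ autFix L (dClosure d (X : Set M)) :=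
  ⟨fun h a ha => h a (hd.mem_dClosure_iff.1 ha), fun h a ha => h a (hd.mem_dClosure_iff.2 ha)⟩

/-- A sequence of automorphisms which converges pointwise together with the sequence of inverses
has an automorphism as its limit. -/
theorem exists_limit_equiv (X : ℕ → Finset M) (s : ℕ → M ≃[L] M) (hX : Monotone X)
    (hcover : ∀ m, ∃ n, m ∈ X n) (hinv : ∀ m, ∃ n, (s n).symm m ∈ X n)
    (hs : ∀ n k m, m ∈ X n → s (n + k) m = s n m) :
    ∃ t : M ≃[L] M, ∀ n, ∀ m ∈ X n, t m = s n m := by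
  choose N hN using hcover
  let F : M → M := fun m => s (N m) m
  have hF : ∀ n, ∀ m ∈ X n, F m = s n m := fun n m hm => by
    rcases le_total n (N m) with h | h
    · obtain ⟨k, hk⟩ := Nat.exists_eq_add_of_le h
      change s (N m) m = _
      rw [hk, hs n k m hm]
    · obtain ⟨k, hk⟩ := Nat.exists_eq_add_of_le h
      rw [hk, hs _ k m (hN m)]
  have hbij : Function.Bijective F := by
    constructor
    · intro a b hab
      have ha := hX (le_max_left (N a) (N b)) (hN a)
      have hb := hX (le_max_right (N a) (N b)) (hN b)
      rw [hF _ a ha, hF _ b hb] at hab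
      exact (s _).injective hab
    -- Convergence of the inverses is what gives surjectivity.
    · intro m
      obtain ⟨n, hn⟩ := hinv m
      exact ⟨_, (hF n _ hn).trans ((s n).apply_symm_apply m)⟩
  have hbound : ∀ {k : ℕ} (x : Fin k → M), ∃ n, ∀ i, x i ∈ X n := fun x =>
    ⟨Finset.univ.sup fun i => N (x i), fun i =>
      hX (Finset.le_sup (f := fun i => N (x i)) (Finset.mem_univ i)) (hN (x i))⟩
  refine ⟨⟨Equiv.ofBijective F hbij, ?_, ?_⟩, fun n m hm => hF n m hm⟩
  · intro k f x
    obtain ⟨n, hn⟩ := hbound x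
    have h1 := hX (le_max_left n (N (FirstOrder.Language.Structure.funMap f x)))
    have h2 := hF _ _ (hX (le_max_right n _) (hN (FirstOrder.Language.Structure.funMap f x)))
    have h3 : F ∘ x = s (max n (N (FirstOrder.Language.Structure.funMap f x))) ∘ x :=
      funext fun i => hF _ _ (h1 (hn i))
    change F _ = FirstOrder.Language.Structure.funMap f (F ∘ x)
    rw [h2, h3, FirstOrder.Language.Equiv.map_fun]
  · intro k r x
    obtain ⟨n, hn⟩ := hbound x
    have h3 : F ∘ x = s n ∘ x := funext fun i => hF _ _ (hn i)
    change FirstOrder.Language.Structure.RelMap r (F ∘ x) ↔ _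
    rw [h3, FirstOrder.Language.Equiv.map_rel]

theorem StandingAssumption.isIndepSystem (hd : StandingAssumption L d)
    (hstat : Stationary L d) : IsIndepSystem (autFix L (dClosure d (∅ : Set M))) d := by
  have hf := hd.isDimensionFunction
  have hm := hf.isMonoSubmodular
  have hsmul : ∀ (g : autFix L (dClosure d (∅ : Set M))) (X : Finset M),
    g • X = X.image (g : M ≃[L] M) := fun g X => rfl
  have hcl : ∀ X : Finset M, dClosure d (X : Set M) ∈ closures d := fun X => ⟨X, rfl⟩
  refine { hm with
    smul_eq := fun g X => hf.invariant g X
    agree_empty := ?_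
    existence := ?_
    stationary := ?_
    faithful := fun s t h => Subtype.ext (FirstOrder.Language.Equiv.ext h)
    complete := ?_ }
  · intro s t a ha
    have ha' : a ∈ dClosure d (∅ : Set M) := by
      rw [← Finset.coe_empty, hm.mem_dClosure_iff]; exact ha
    exact (s.2 a ha').trans (t.2 a ha').symm
  · intro A B C
    obtain ⟨g, hg, hi⟩ := hd.existence _ (hcl A) _ (hcl B) _ (hcl C)
    refine ⟨⟨g, autFix_mono (hm.dClosure_empty_subset B) hg⟩, hm.agreeOn_one_iff.2 hg, ?_⟩
    rwa [hf.image_dClosure, hm.indep_dClosure_iff] at hi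
  · intro A B C h hB hA hA'
    have hBfix := hm.agreeOn_one_iff.1 hB
    have hAB : (A ∪ B).image (h : M ≃[L] M) = h • A ∪ B := by
      rw [← hsmul, Finset.smul_finset_union, hB.smul_finset_self subset_rfl]
    -- `Stationary` requires the base inside both sides, hence `A ∪ B`; independence over `B` is
    -- unaffected.
    obtain ⟨k, hk, hkC⟩ := hstat _ (hcl (A ∪ B)) _ (hcl ((A ∪ B).image (h : M ≃[L] M))) _ (hcl B) _
      (hcl C) (hm.dClosure_subset_iff.2 (IsMonoSubmodular.subCl_of_subset (by grind)))
      (hm.dClosure_subset_iff.2 (IsMonoSubmodular.subCl_of_subset (by rw [hAB]; grind)))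
      ((hm.indep_dClosure_iff _ _ _).2 (hm.finIndep_mono hA (by grind) (by grind)))
      ((hm.indep_dClosure_iff _ _ _).2
        (by rw [hAB]; exact hm.finIndep_mono hA' (by grind) (by grind)))
      h (hf.image_dClosure _ _) hBfix
    exact ⟨⟨k, autFix_mono (hm.dClosure_empty_subset C) hkC⟩, hm.agreeOn_one_iff.2 hkC,
      fun a ha => hk a (hm.mem_dClosure_iff.2 ha)⟩
  · intro X s hX hcover hinv hs
    have hmono : Monotone X := monotone_nat_of_le_succ hX
    have hstab : ∀ n k m, SubCl d {m} (X n) → s (n + k) • m = s n • m := by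
      intro n k m hmX
      induction k with
      | zero => rfl
      | succ k ih =>
        rw [← ih]
        exact hs (n + k) m (hm.subCl_mono hmX (hmono (Nat.le_add_right n k)) subset_rfl)
    obtain ⟨t, ht⟩ := exists_limit_equiv X (fun n => (s n : M ≃[L] M)) hmono hcover hinv
      fun n k m hmX => hstab n k m (IsMonoSubmodular.subCl_of_subset (by simpa using hmX))
    have ht' : ∀ n m, SubCl d {m} (X n) → t m = s n • m := by
      intro n m hmX
      obtain ⟨k, hk⟩ := hcover m
      have h1 := hmono (Nat.le_add_left k n) hk
      exact (ht _ m h1).trans (hstab n k m hmX)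
    refine ⟨⟨t, fun a ha => ?_⟩, fun n a ha => ht' n a ha⟩
    exact (ht' 0 a (hm.mem_dClosure_iff.1 (hm.dClosure_empty_subset _ ha))).trans ((s 0).2 a ha)

theorem StandingAssumption.isGeneratingBasicOrbit (hd : StandingAssumption L d)
    (hstat : Stationary L d) {A : Finset M} {b : M} (hb : IsBasic d b (dClosure d (A : Set M)))
    (hgen : dClosure d (dClosure d (A : Set M) ∪ orb L b (dClosure d (A : Set M))) = Set.univ) :
    IsGeneratingBasicOrbit (autFix L (dClosure d (∅ : Set M))) d A
      (orb L b (dClosure d (A : Set M))) (d (A ∪ {b}) - d A) := by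
  have H := hd.isIndepSystem hstat
  have hm := H.toIsMonoSubmodular
  have horb : ∀ c ∈ orb L b (dClosure d (A : Set M)),
      ∃ k : autFix L (dClosure d (∅ : Set M)), AgreeOn d A k 1 ∧ k • b = c := by
    rintro c ⟨f, hf, rfl⟩
    exact ⟨⟨f, autFix_mono (hm.dClosure_empty_subset A) hf⟩, hm.agreeOn_one_iff.2 hf, rfl⟩
  have hrel : ∀ C : Finset M, relDim d {b} (dClosure d (C : Set M)) = d (C ∪ {b}) - d C :=
    fun C => by
      rw [hm.relDim_eq {b} (hm.subset_dClosure C) fun z hz => hm.mem_dClosure_iff.1 hz,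
        Finset.union_comm]
  have hdim : ∀ C : Finset M, A ⊆ C → ¬ SubCl d {b} C →
      d (C ∪ {b}) = d C + (d (A ∪ {b}) - d A) := by
    intro C hAC hbC
    -- Submodularity bounds the dimension of `b` over `C` by that over `A`, and a strict drop would
    -- put `b` in the closure of `C`.
    have h1 := hb.2 _ ⟨C, rfl⟩ (hm.dClosure_subset_iff.2 (IsMonoSubmodular.subCl_of_subset hAC))
    rw [hrel, hrel, hm.mem_dClosure_iff] at h1
    have h2 := hm.submod_of_subset (U := C ∪ {b}) (Z := A) (X := C) (Y := A ∪ {b})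
      (by grind) hAC (by grind)
    by_contra h3
    exact hbC (h1 (lt_of_le_of_ne (by linarith) fun h => h3 (by linarith)))
  refine ⟨?_, ?_, ?_, ?_, ?_, ?_⟩
  · have h1 := hm.mono (show A ⊆ A ∪ {b} by grind)
    have h2 := hb.1
    rw [hm.mem_dClosure_iff] at h2
    unfold SubCl at h2
    omega
  · intro c hc C hAC hcC
    obtain ⟨k, hk, rfl⟩ := horb c hc
    have h1 := hdim (k⁻¹ • C)
      (by rwa [← Finset.smul_finset_subset_iff, hk.smul_finset_self subset_rfl])
      (by rwa [← H.subCl_smul_singleton_iff k, smul_inv_smul])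
    rwa [← H.smul_eq k, Finset.smul_finset_union, smul_inv_smul, Finset.smul_finset_singleton,
      H.smul_eq] at h1
  · intro c hc
    obtain ⟨k, hk, rfl⟩ := horb c hc
    have h1 := H.smul_eq k (A ∪ {b})
    rw [Finset.smul_finset_union, hk.smul_finset_self subset_rfl,
      Finset.smul_finset_singleton] at h1
    rw [h1]
    ring
  · rintro c ⟨f, hf, rfl⟩ k hk
    exact ⟨k * f, mul_mem (hm.agreeOn_one_iff.1 hk) hf, rfl⟩
  · intro c hc c' hc'
    obtain ⟨k, hk, rfl⟩ := horb c hc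
    obtain ⟨l, hl, rfl⟩ := horb c' hc'
    exact ⟨l * k⁻¹, hl.mul_one hk.inv_one, by rw [mul_smul, inv_smul_smul]⟩
  · intro m
    have h1 : relDim d {m} (dClosure d (A : Set M) ∪ orb L b (dClosure d (A : Set M))) = 0 :=
      (Set.eq_univ_iff_forall.1 hgen m)
    have h2 : relDim d {m} (dClosure d (A : Set M) ∪ orb L b (dClosure d (A : Set M))) ∈
        {n : ℤ | ∃ Y : Finset M, (Y : Set M) ⊆
          dClosure d (A : Set M) ∪ orb L b (dClosure d (A : Set M)) ∧ n = d ({m} ∪ Y) - d Y} :=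
      -- The infimum is attained, which yields a finite `Y` with `m` in its closure; the elements of
      -- `Y` outside the orbit are already in the closure of `A`.
      Int.csInf_mem ⟨_, ∅, by simp, rfl⟩ ⟨0, by
        rintro _ ⟨Y, -, rfl⟩
        have := hm.mono (show Y ⊆ {m} ∪ Y by grind)
        linarith⟩
    obtain ⟨Y, hY, hmY⟩ := h2
    rw [h1] at hmY
    refine ⟨Y.filter (· ∈ orb L b (dClosure d (A : Set M))), ?_, ?_⟩
    · intro y hy
      rw [Finset.mem_coe, Finset.mem_filter] at hy
      exact hy.2
    · have hmY' : SubCl d {m} Y := by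
        unfold SubCl
        rw [Finset.union_comm]
        linarith
      refine hm.subCl_trans hmY' (hm.subCl_of_forall fun y hy => ?_)
      rcases hY hy with h | h
      · exact hm.subCl_mono (hm.mem_dClosure_iff.1 h) (by grind) subset_rfl
      · refine IsMonoSubmodular.subCl_of_subset ?_
        rw [Finset.singleton_subset_iff, Finset.mem_union, Finset.mem_filter]
        exact .inr ⟨hy, h⟩

/-- `IsUnbounded` only speaks of one inclusion, which is enough because `g` preserves dimension.
Replacing `B` by `B ∪ E` turns containment of `E` in the closure into literal containment. -/
theorem isUnbounded_of_not_isClBounded (hf : IsDimensionFunction L d)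
    {g : autFix L (dClosure d (∅ : Set M))} (hg : ¬ IsClBounded d (g : M ≃[L] M)) :
    IsUnbounded d g := by
  have hm := hf.isMonoSubmodular
  intro E
  by_contra! hE
  refine hg ⟨_, ⟨E, rfl⟩, ?_⟩
  rintro _ ⟨B, rfl⟩ hEB
  rw [hm.dClosure_subset_iff] at hEB
  have hBE : dClosure d (B : Set M) = dClosure d ((B ∪ E : Finset M) : Set M) :=
    (hm.dClosure_subset_iff.2 (IsMonoSubmodular.subCl_of_subset (by grind))).antisymm
      (hm.dClosure_subset_iff.2 (hm.subCl_union (IsMonoSubmodular.subCl_of_subset subset_rfl) hEB))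
  have h1 : SubCl d ((B ∪ E).image (g : M ≃[L] M)) (B ∪ E) := hE _ Finset.subset_union_right
  rw [hBE, hf.image_dClosure]
  refine (hm.dClosure_subset_iff.2 h1).antisymm (hm.dClosure_subset_iff.2 ?_)
  unfold SubCl at *
  rw [Finset.union_comm, h1, hf.invariant]

end Automorphisms

end DimIndep

theorem corollary3p13 {L : FirstOrder.Language} {M : Type*} [L.Structure M] [Countable M]
    (d : Finset M → ℤ) (hd : DimIndep.StandingAssumption L d)
    (hstat : DimIndep.Stationary L d)
    (A : Set M) (hA : A ∈ DimIndep.closures d)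
    (D : Set M) (hD : DimIndep.IsBasicOrbit L d D A)
    (hAD : DimIndep.dClosure d (A ∪ D) = Set.univ)
    (g : DimIndep.autFix L (DimIndep.dClosure d (∅ : Set M)))
    (hg : ¬ DimIndep.IsClBounded d (g : L.Equiv M M))
    (f : DimIndep.autFix L (DimIndep.dClosure d (∅ : Set M))) :
    ∃ l : List (DimIndep.autFix L (DimIndep.dClosure d (∅ : Set M))),
      l.length = 96 ∧ (∀ x ∈ l, IsConj g x ∨ IsConj g⁻¹ x) ∧ l.prod = f := by
  classical
  obtain ⟨A₀, rfl⟩ := hA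
  obtain ⟨b, hb, rfl⟩ := hD
  have H := hd.isIndepSystem hstat
  have hD := hd.isGeneratingBasicOrbit hstat hb hAD
  have hu := DimIndep.isUnbounded_of_not_isClBounded hd.isDimensionFunction hg
  obtain ⟨h, k, hf⟩ := DimIndep.exists_fourConj_eq_mul_fourConj H
    (hD.movesAlmostMaximally H hu) (hD.movesAlmostMaximally H (H.isUnbounded_inv hu)) f
  exact DimIndep.exists_list_isConj g hf
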